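/- **Notation.** For two probability measures $\mu,\nu$ on the same space, $H(\mu|\nu)=\int h\log h\,d\nu\in[0,+\infty]$ with $h=d\mu/d\nu$ if $\mu\ll\nu$, and $H(\mu|\nu)=+\infty$ otherwise. For $N\ge1$ let $S^{N-1}(\sqrt N)\subset\mathbb R^N$ be the sphere of radius $\sqrt N$ centred at $0$ and $\sigma^N$ the uniform probability measure on it. A probability measure on $S^{N-1}(\sqrt N)$ is symmetric if it is invariant under all permutations of the coordinates $v_1,\dots,v_N$; $P_k m$ denotes the marginal on $\mathbb R^k$ of $m$ in the first $k$ coordinates ($k\le N$). Given a probability density $g$ on $\mathbb R$ and $\nu(dv)=g(v)\,dv$, put $$Z_N(g,\sqrt N)=\int_{S^{N-1}(\sqrt N)}\prod_{j=1}^N g(v_j)\,d\sigma^N(v),\qquad [\nu^{\otimes N}]_{S^{N-1}(\sqrt N)}=\frac{\prod_{j=1}^N g(v_j)}{Z_N(g,\sqrt N)}\,\sigma^N .$$ Weak convergence means convergence against bounded continuous functions. Let $\gamma$ be the standard Gaussian measure on $\mathbb R$. **Theorem.** (a) Let $g$ be a probability density on $\mathbb R$ with $$\int g(x)x^2\,dx=1,\qquad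 \int g(x)x^4\,dx<+\infty,\qquad g\in L^p(\mathbb R)\ \text{ for some } p>1,$$ and let $\nu(dv)=g(v)\,dv$. Then $0<Z_N(g,\sqrt N)<+\infty$ for all sufficiently large $N$, so that $[\nu^{\otimes N}]_{S^{N-1}(\sqrt N)}$ is a well-defined probability measure. For each positive integer $N$ let $\mu^{(N)}$ be a symmetric probability measure on $S^{N-1}(\sqrt N)$. If $P_1\mu^{(N)}\to\mu$ weakly as $N\to\infty$ for a probability measure $\mu$ on $\mathbb R$, then $$H(\mu|\nu)\le\liminf_{N\to\infty}\frac{H\bigl(\mu^{(N)}\,\big|\,[\nu^{\otimes N}]_{S^{N-1}(\sqrt N)}\bigr)}{N}.$$ More generally, if for some positive integer $k$, $P_k\mu^{(N)}\to\mu_k$ weakly as $N\to\infty$ for a probability measure $\mu_k$ on $\mathbb R^k$, then $$\frac{H(\mu_k|\nu^{\otimes k})}{k}\le\liminf_{N\to\infty}\frac{H\bigl(\mu^{(N)}\,\big|\,[\nu^{\otimes N}]_{S^{N-1}(\sqrt N)}\bigr)}{N}.$$ (b) Let $\mu$ be a probability measure on $\mathbb R$ and let $(\mu^{(N)})_{N\ge1}$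 be $\mu$-chaotic, i.e. each $\mu^{(N)}$ is a symmetric probability measure on $S^{N-1}(\sqrt N)$ and, for every positive integer $k$, $P_k\mu^{(N)}\to\mu^{\otimes k}$ weakly as $N\to\infty$. Then $$H(\mu|\gamma)\le\liminf_{N\to\infty}\frac{H(\mu^{(N)}|\sigma^N)}{N}.$$ -/

import Mathlib

open MeasureTheory Filter Topology ProbabilityTheory InformationTheory
open scoped ENNReal

namespace KacChaos

/-- The sphere `S^{N-1}(√N)` in the Euclidean space `ℝ^N`. -/
abbrev KacSphere (N : ℕ) : Type :=
  Metric.sphere (0 : EuclideanSpace ℝ (Fin N)) (Real.sqrt N)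

/-- The dilation of the unit sphere of `ℝ^N` onto the sphere of radius `√N`. -/
noncomputable def dilate (N : ℕ) (x : Metric.sphere (0 : EuclideanSpace ℝ (Fin N)) 1) :
    KacSphere N :=
  ⟨Real.sqrt N • (x : EuclideanSpace ℝ (Fin N)), by
    simp [norm_smul, abs_of_nonneg (Real.sqrt_nonneg _)]⟩

/-- The uniform probability measure `σ^N` on `S^{N-1}(√N)`, for `N ≥ 1`: the image under dilation
of the normalized surface measure of the unit sphere. -/
noncomputable def unif (N : ℕ) : Measure (KacSphere N) :=
  ((volume : Measure (EuclideanSpace ℝ (Fin N))).toSphere Set.univ)⁻¹ •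
    (volume : Measure (EuclideanSpace ℝ (Fin N))).toSphere.map (dilate N)

/-- The function `(v_1, …, v_N) ↦ ∏_j g(v_j)` on `S^{N-1}(√N)`. -/
noncomputable def tensorDensity (g : ℝ → ℝ) (N : ℕ) (v : KacSphere N) : ℝ≥0∞ :=
  ∏ j : Fin N, ENNReal.ofReal (g ((v : EuclideanSpace ℝ (Fin N)) j))

/-- The normalizing constant `Z_N(g, √N) = ∫ ∏_j g(v_j) dσ^N(v)`. -/
noncomputable def Z (g : ℝ → ℝ) (N : ℕ) : ℝ≥0∞ :=
  ∫⁻ v, tensorDensity g N v ∂(unif N)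

/-- The conditioned tensor product `[ν^{⊗N}]_{S^{N-1}(√N)}` for `ν(dv) = g(v) dv`: the measure with
density `Z_N(g, √N)⁻¹ ∏_j g(v_j)` with respect to `σ^N`. -/
noncomputable def condTensor (g : ℝ → ℝ) (N : ℕ) : Measure (KacSphere N) :=
  (Z g N)⁻¹ • (unif N).withDensity (tensorDensity g N)

/-- The measure `ν(dv) = g(v) dv` on `ℝ`. -/
noncomputable def densityMeasure (g : ℝ → ℝ) : Measure ℝ :=
  volume.withDensity fun v => ENNReal.ofReal (g v)

/-- The action of a permutation of the coordinates on `S^{N-1}(√N)`. -/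
noncomputable def permute {N : ℕ} (τ : Equiv.Perm (Fin N)) (v : KacSphere N) : KacSphere N :=
  ⟨WithLp.toLp 2 fun i => (v : EuclideanSpace ℝ (Fin N)) (τ i), by
    have h := v.2
    rw [mem_sphere_zero_iff_norm, EuclideanSpace.norm_eq] at h ⊢
    refine Eq.trans ?_ h
    exact congrArg _ (Equiv.sum_comp τ fun i => ‖(v : EuclideanSpace ℝ (Fin N)) i‖ ^ 2)⟩

/-- Symmetry of a probability measure on `S^{N-1}(√N)` under permutations of `v_1, …, v_N`. -/
def IsSymmetric {N : ℕ} (m : ProbabilityMeasure (KacSphere N)) : Prop :=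
  ∀ τ : Equiv.Perm (Fin N),
    (m : Measure (KacSphere N)).map (permute τ) = (m : Measure (KacSphere N))

/-- The first `k` coordinates `(v_1, …, v_k)` of a point of `S^{N-1}(√N)`. When `k > N` (a case
that concerns only finitely many `N`) the missing coordinates are set to `0`. -/
noncomputable def firstCoords (k N : ℕ) (v : KacSphere N) : Fin k → ℝ :=
  fun i => if h : (i : ℕ) < N then (v : EuclideanSpace ℝ (Fin N)) ⟨i, h⟩ else 0

theorem measurable_firstCoords (k N : ℕ) : Measurable (firstCoords k N) := by
  refine measurable_pi_lambda _ fun i => ?_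
  unfold firstCoords
  split_ifs with h
  · fun_prop
  · fun_prop

/-- The marginal `P_k m` of `m` on the first `k` coordinates, a probability measure on `ℝ^k`. -/
noncomputable def marginal (k : ℕ) {N : ℕ} (m : ProbabilityMeasure (KacSphere N)) :
    ProbabilityMeasure (Fin k → ℝ) :=
  m.map (measurable_firstCoords k N).aemeasurable

/-- The first marginal `P_1 m`, as a probability measure on `ℝ`. -/
noncomputable def marginalOne {N : ℕ} (m : ProbabilityMeasure (KacSphere N)) :
    ProbabilityMeasure ℝ :=
  (marginal 1 m).map (measurable_pi_apply (0 : Fin 1)).aemeasurable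

/-- The tensor power `μ^{⊗k}`, a probability measure on `ℝ^k`. -/
noncomputable def tensorPower (μ : ProbabilityMeasure ℝ) (k : ℕ) :
    ProbabilityMeasure (Fin k → ℝ) :=
  ⟨Measure.pi fun _ => (μ : Measure ℝ), inferInstance⟩

/-- `μ`-chaoticity of a sequence of probability measures on the spheres `S^{N-1}(√N)`. -/
def IsChaotic (μ : ProbabilityMeasure ℝ) (m : ∀ N : ℕ, ProbabilityMeasure (KacSphere N)) : Prop :=
  (∀ N, 0 < N → IsSymmetric (m N)) ∧
    ∀ k : ℕ, 0 < k → Tendsto (fun N => marginal k (m N)) atTop (𝓝 (tensorPower μ k))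

end KacChaos

/-!
By the Donsker–Varadhan formula a relative entropy is the supremum of `∫ φ dμ - log ∫ e^φ dν` over
bounded continuous `φ`. Given a test function `φ` of `k` variables, test the entropy on the sphere
with the sum of `φ` over `⌊r / k⌋` disjoint blocks of `k` coordinates chosen among the last
`r = N - d` ones: by symmetry its mean only involves the `k`-th marginal, so the claim follows if
conditioning on the sphere costs only a factor `e^{o(N)}` in the exponential moments of functions of
these `r` coordinates.

Disintegrating along the energy `∑ v_j²` gives such a bound. If `h` denotes the density of `v²` for
`v` of law `ν`, then `Z_N` is an explicit constant `c_N` times the `N`-fold convolution power of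
`h` at `N`, whereas the law of the last `r` coordinates under the conditioned measure is at most
`c_N sup h^{*d} / Z_N` times `ν^{⊗ r}`. For `g ∈ L^p` some convolution power `h^{*d}` is bounded,
and the law of large numbers, used in place of a local central limit theorem, forces
`h^{*N} N ≥ e^{-εN}` for all large `N`.
-/

namespace KacChaos

section Entropy

variable {α : Type*} [MeasurableSpace α]

theorem integrable_of_abs_le {μ : Measure α} [IsFiniteMeasure μ] {f : α → ℝ} (hf : Measurable f)
    {C : ℝ} (hC : ∀ x, |f x| ≤ C) : Integrable f μ :=
  Integrable.of_bound hf.aestronglyMeasurable C (Eventually.of_forall hC)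

theorem integrable_exp_of_abs_le {μ : Measure α} [IsFiniteMeasure μ] {f : α → ℝ}
    (hf : Measurable f) {C : ℝ} (hC : ∀ x, |f x| ≤ C) : Integrable (fun x => Real.exp (f x)) μ :=
  integrable_of_abs_le (C := Real.exp C) (Real.measurable_exp.comp hf) fun x => by
    rw [abs_of_pos (Real.exp_pos _)]
    exact Real.exp_le_exp.2 ((le_abs_self _).trans (hC x))

theorem ofReal_integral_sub_log_integral_exp_le_klDiv (μ ν : Measure α) [IsProbabilityMeasure μ]
    [IsProbabilityMeasure ν] {f : α → ℝ} (hf : Measurable f) {C : ℝ} (hC : ∀ x, |f x| ≤ C) :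
    ENNReal.ofReal (∫ x, f x ∂μ - Real.log (∫ x, Real.exp (f x) ∂ν)) ≤ klDiv μ ν := by
  by_cases h : μ ≪ ν ∧ Integrable (llr μ ν) μ
  swap
  · rw [klDiv_eq_top_iff.2 fun h1 h2 => h ⟨h1, h2⟩]
    exact le_top
  obtain ⟨hac, hint⟩ := h
  have hexp := integrable_exp_of_abs_le (μ := ν) hf hC
  have hfμ := integrable_of_abs_le (μ := μ) hf hC
  have := isProbabilityMeasure_tilted hexp
  -- The relative entropy of `μ` with respect to the tilted measure `e^f ν / ∫ e^f dν` is
  -- nonnegative.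
  have h1 := integral_llr_add_sub_measure_univ_nonneg
    (hac.trans (absolutelyContinuous_tilted hexp))
    (integrable_llr_tilted_right hac hfμ hint hexp)
  rw [integral_llr_tilted_right hac hfμ hexp hint] at h1
  rw [klDiv_of_ac_of_integrable hac hint]
  refine ENNReal.ofReal_le_ofReal ?_
  simp only [probReal_univ] at h1 ⊢
  linarith

theorem exists_boundedContinuous_tendsto_ae [TopologicalSpace α] [NormalSpace α] [BorelSpace α]
    (μ : Measure α) [IsFiniteMeasure μ] [μ.WeaklyRegular] {f : α → ℝ} (hf : Measurable f)
    {C : ℝ} (hC : ∀ x, |f x| ≤ C) :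
    ∃ φ : ℕ → BoundedContinuousFunction α ℝ, (∀ n x, |φ n x| ≤ |C|) ∧
      ∀ᵐ x ∂μ, Tendsto (fun n => φ n x) atTop (𝓝 (f x)) := by
  have hmem : MemLp f 1 μ := memLp_one_iff_integrable.2 (integrable_of_abs_le hf hC)
  have approx : ∀ n : ℕ, ∃ u : BoundedContinuousFunction α ℝ,
      eLpNorm (f - ⇑u) 1 μ ≤ ((n : ℝ≥0∞) + 1)⁻¹ := fun n => by
    obtain ⟨u, hu, -⟩ := hmem.exists_boundedContinuous_eLpNorm_sub_le ENNReal.one_ne_top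
      (ε := ((n : ℝ≥0∞) + 1)⁻¹) (by simp)
    exact ⟨u, hu⟩
  choose u hu using approx
  have hlim : Tendsto (fun n => eLpNorm (⇑(u n) - f) 1 μ) atTop (𝓝 0) := by
    refine tendsto_of_tendsto_of_tendsto_of_le_of_le tendsto_const_nhds
      (h := fun n : ℕ => ((n : ℝ≥0∞) + 1)⁻¹) ?_ (fun _ => bot_le) fun n => ?_
    · simpa [Function.comp_def] using
        ENNReal.tendsto_inv_nat_nhds_zero.comp (tendsto_add_atTop_nat 1)
    · rw [eLpNorm_sub_comm]
      exact hu n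
  obtain ⟨ns, -, hns⟩ := (tendstoInMeasure_of_tendsto_eLpNorm one_ne_zero
    (fun n => (u n).continuous.measurable.aestronglyMeasurable)
    hf.aestronglyMeasurable hlim).exists_seq_tendsto_ae
  refine ⟨fun n => .const α (-|C|) ⊔ u (ns n) ⊓ .const α |C|, fun n x => ?_, ?_⟩
  · simp [abs_le]
  · filter_upwards [hns] with x hx
    have hfx := abs_le.1 ((hC x).trans (le_abs_self C))
    simpa [hfx.1, hfx.2] using
      (tendsto_const_nhds (x := -|C|)).max (Tendsto.min hx (tendsto_const_nhds (x := |C|)))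

theorem integral_sub_log_integral_exp_le_of_forall_boundedContinuous [TopologicalSpace α]
    [NormalSpace α] [BorelSpace α] (μ ν : Measure α) [IsProbabilityMeasure μ]
    [IsProbabilityMeasure ν] [(μ + ν).WeaklyRegular] {L : ℝ}
    (h : ∀ φ : BoundedContinuousFunction α ℝ,
      ∫ x, φ x ∂μ - Real.log (∫ x, Real.exp (φ x) ∂ν) ≤ L)
    {f : α → ℝ} (hf : Measurable f) {C : ℝ} (hC : ∀ x, |f x| ≤ C) :
    ∫ x, f x ∂μ - Real.log (∫ x, Real.exp (f x) ∂ν) ≤ L := by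
  obtain ⟨φ, hφ, hlim⟩ := exists_boundedContinuous_tendsto_ae (μ + ν) hf hC
  rw [ae_add_measure_iff] at hlim
  have hμ : Tendsto (fun n => ∫ x, φ n x ∂μ) atTop (𝓝 (∫ x, f x ∂μ)) :=
    tendsto_integral_of_dominated_convergence (fun _ => |C|)
      (fun n => (φ n).continuous.measurable.aestronglyMeasurable) (integrable_const _)
      (fun n => Eventually.of_forall fun x => hφ n x) hlim.1
  have hν : Tendsto (fun n => ∫ x, Real.exp (φ n x) ∂ν) atTop (𝓝 (∫ x, Real.exp (f x) ∂ν)) := by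
    refine tendsto_integral_of_dominated_convergence (fun _ => Real.exp |C|)
      (fun n => (Real.measurable_exp.comp (φ n).continuous.measurable).aestronglyMeasurable)
      (integrable_const _) (fun n => Eventually.of_forall fun x => ?_) ?_
    · rw [Real.norm_eq_abs, abs_of_pos (Real.exp_pos _)]
      exact Real.exp_le_exp.2 ((le_abs_self _).trans (hφ n x))
    · filter_upwards [hlim.2] with x hx
      exact (Real.continuous_exp.tendsto _).comp hx
  have hpos : 0 < ∫ x, Real.exp (f x) ∂ν := integral_exp_pos (integrable_exp_of_abs_le hf hC)
  exact le_of_tendsto (hμ.sub (hν.log hpos.ne')) (Eventually.of_forall fun n => h (φ n))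

theorem absolutelyContinuous_of_forall_integral_sub_log_integral_exp_le (μ ν : Measure α)
    [IsProbabilityMeasure μ] [IsProbabilityMeasure ν] {L : ℝ}
    (h : ∀ (f : α → ℝ) (C : ℝ), Measurable f → (∀ x, |f x| ≤ C) →
      ∫ x, f x ∂μ - Real.log (∫ x, Real.exp (f x) ∂ν) ≤ L) :
    μ ≪ ν := by
  refine Measure.AbsolutelyContinuous.mk fun s hs hνs => ?_
  by_contra hne
  have hpos : 0 < μ.real s := ENNReal.toReal_pos hne (measure_ne_top _ _)
  have hbound : ∀ t : ℝ, t * μ.real s ≤ L := fun t => by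
    have h1 := h (s.indicator fun _ => t) |t| (measurable_const.indicator hs) fun x => by
      by_cases hx : x ∈ s <;> simp [hx]
    have h2 : ∫ x, Real.exp (s.indicator (fun _ => t) x) ∂ν = 1 := by
      have : (fun x => Real.exp (s.indicator (fun _ => t) x)) =ᵐ[ν] fun _ => 1 := by
        filter_upwards [measure_eq_zero_iff_ae_notMem.1 hνs] with x hx
        simp [hx]
      rw [integral_congr_ae this]
      simp
    rw [h2, Real.log_one, integral_indicator hs] at h1
    simpa [mul_comm] using h1
  have := hbound ((L + 1) / μ.real s)
  rw [div_mul_cancel₀ _ hpos.ne'] at this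
  linarith

/-- The truncation of `x` to the interval `[e^{-n}, e^n]`, so that its logarithm is bounded. -/
noncomputable def expClamp (n : ℕ) (x : ℝ) : ℝ := max (Real.exp (-n)) (min x (Real.exp n))

theorem expClamp_pos (n : ℕ) (x : ℝ) : 0 < expClamp n x := lt_max_of_lt_left (Real.exp_pos _)

@[fun_prop]
theorem continuous_expClamp (n : ℕ) : Continuous (expClamp n) := by
  unfold expClamp
  fun_prop

theorem abs_log_expClamp_le (n : ℕ) (x : ℝ) : |Real.log (expClamp n x)| ≤ n := by
  have hle : Real.exp (-n) ≤ Real.exp n := Real.exp_le_exp.2 (by linarith [n.cast_nonneg (α := ℝ)])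
  rw [abs_le, Real.le_log_iff_exp_le (expClamp_pos n x), Real.log_le_iff_le_exp (expClamp_pos n x)]
  exact ⟨le_max_left _ _, max_le hle (min_le_right _ _)⟩

theorem tendsto_expClamp {x : ℝ} (hx : 0 ≤ x) :
    Tendsto (fun n => expClamp n x) atTop (𝓝 x) := by
  have h1 : Tendsto (fun n : ℕ => Real.exp (-(n : ℝ))) atTop (𝓝 0) :=
    Real.tendsto_exp_neg_atTop_nhds_zero.comp tendsto_natCast_atTop_atTop
  have h2 : Tendsto (fun n : ℕ => min x (Real.exp n)) atTop (𝓝 x) :=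
    tendsto_const_nhds.congr' <| ((Real.tendsto_exp_atTop.comp
      tendsto_natCast_atTop_atTop).eventually_ge_atTop x).mono fun n hn => (min_eq_left hn).symm
  simpa [hx, expClamp] using h1.max h2

theorem mul_log_expClamp_nonneg (n : ℕ) (x : ℝ) :
    0 ≤ x * Real.log (expClamp n x) + 1 - expClamp n x := by
  have hmono : 0 ≤ (x - expClamp n x) * Real.log (expClamp n x) := by
    rcases le_total x 1 with hx | hx
    · have hxn : min x (Real.exp n) = x :=
        min_eq_left (hx.trans (Real.one_le_exp n.cast_nonneg))
      have h1 : x ≤ expClamp n x := hxn.ge.trans (le_max_right _ _)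
      have h2 : expClamp n x ≤ 1 := by
        rw [expClamp, hxn]
        exact max_le (Real.exp_le_one_iff.2 (by simp)) hx
      exact mul_nonneg_of_nonpos_of_nonpos (by linarith)
        (Real.log_nonpos (expClamp_pos n x).le h2)
    · have h0 : Real.exp (-n) ≤ 1 := Real.exp_le_one_iff.2 (by simp)
      have h1 : expClamp n x ≤ x := max_le (h0.trans hx) (min_le_left _ _)
      have h2 : 1 ≤ expClamp n x := le_max_of_le_right (le_min hx (Real.one_le_exp n.cast_nonneg))
      exact mul_nonneg (by linarith) (Real.log_nonneg h2)
  have hkl := klFun_nonneg (expClamp_pos n x).le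
  rw [klFun_apply] at hkl
  linarith

theorem tendsto_mul_log_expClamp {x : ℝ} (hx : 0 ≤ x) :
    Tendsto (fun n => x * Real.log (expClamp n x) + 1 - expClamp n x) atTop (𝓝 (klFun x)) := by
  rw [klFun_apply]
  rcases hx.eq_or_lt with rfl | hpos
  · simpa using (tendsto_expClamp le_rfl).const_sub 1
  · exact (((tendsto_expClamp hx).log hpos.ne').const_mul x |>.add_const 1).sub
      (tendsto_expClamp hx)

theorem lintegral_rnDeriv_mul_add_one_sub_exp_le (μ ν : Measure α) [IsProbabilityMeasure μ]
    [IsProbabilityMeasure ν] (hac : μ ≪ ν) {f : α → ℝ} (hf : Measurable f) {C : ℝ}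
    (hC : ∀ x, |f x| ≤ C)
    (hnonneg : ∀ x, 0 ≤ (μ.rnDeriv ν x).toReal * f x + 1 - Real.exp (f x)) :
    ∫⁻ x, ENNReal.ofReal ((μ.rnDeriv ν x).toReal * f x + 1 - Real.exp (f x)) ∂ν ≤
      ENNReal.ofReal (∫ x, f x ∂μ - Real.log (∫ x, Real.exp (f x) ∂ν)) := by
  have hexp := integrable_exp_of_abs_le (μ := ν) hf hC
  have hrf : Integrable (fun x => (μ.rnDeriv ν x).toReal * f x) ν :=
    (integrable_rnDeriv_smul_iff hac).2 (integrable_of_abs_le hf hC)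
  have hrf_eq : ∫ x, (μ.rnDeriv ν x).toReal * f x ∂ν = ∫ x, f x ∂μ := integral_rnDeriv_smul hac
  have hrf1 : Integrable (fun x => (μ.rnDeriv ν x).toReal * f x + 1) ν :=
    hrf.add (integrable_const _)
  rw [← ofReal_integral_eq_lintegral_ofReal
    (f := fun x => (μ.rnDeriv ν x).toReal * f x + 1 - Real.exp (f x)) (hrf1.sub hexp)
    (Eventually.of_forall hnonneg)]
  refine ENNReal.ofReal_le_ofReal ?_
  rw [integral_sub hrf1 hexp, integral_add hrf (integrable_const _), hrf_eq, integral_const,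
    probReal_univ, one_smul]
  linarith [Real.log_le_sub_one_of_pos (integral_exp_pos hexp)]

theorem klDiv_le_of_forall_integral_sub_log_integral_exp_le (μ ν : Measure α)
    [IsProbabilityMeasure μ] [IsProbabilityMeasure ν] {L : ℝ}
    (h : ∀ (f : α → ℝ) (C : ℝ), Measurable f → (∀ x, |f x| ≤ C) →
      ∫ x, f x ∂μ - Real.log (∫ x, Real.exp (f x) ∂ν) ≤ L) :
    klDiv μ ν ≤ ENNReal.ofReal L := by
  have hac := absolutelyContinuous_of_forall_integral_sub_log_integral_exp_le μ ν h
  set r : α → ℝ := fun x => (μ.rnDeriv ν x).toReal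
  have hr : Measurable r := (Measure.measurable_rnDeriv μ ν).ennreal_toReal
  let ψ : ℕ → α → ℝ := fun n x => Real.log (expClamp n (r x))
  have hψ : ∀ n, Measurable (ψ n) := fun n =>
    Real.measurable_log.comp ((continuous_expClamp n).measurable.comp hr)
  have hψ_le : ∀ n x, |ψ n x| ≤ n := fun n x => abs_log_expClamp_le n _
  have hexp_ψ : ∀ n x, Real.exp (ψ n x) = expClamp n (r x) := fun n x =>
    Real.exp_log (expClamp_pos n _)
  rw [klDiv_eq_lintegral_klFun_of_ac hac]
  calc ∫⁻ x, ENNReal.ofReal (klFun (r x)) ∂ν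
      = ∫⁻ x, liminf (fun n => ENNReal.ofReal (r x * ψ n x + 1 - Real.exp (ψ n x))) atTop ∂ν := by
        refine lintegral_congr fun x => Eq.symm (Tendsto.liminf_eq ?_)
        simp only [hexp_ψ]
        exact (ENNReal.continuous_ofReal.tendsto _).comp
          (tendsto_mul_log_expClamp ENNReal.toReal_nonneg)
    _ ≤ liminf (fun n => ∫⁻ x, ENNReal.ofReal (r x * ψ n x + 1 - Real.exp (ψ n x)) ∂ν) atTop :=
        lintegral_liminf_le fun n => by fun_prop
    _ ≤ liminf (fun _ : ℕ => ENNReal.ofReal L) atTop := by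
        refine liminf_le_liminf (Eventually.of_forall fun n => ?_)
        refine (lintegral_rnDeriv_mul_add_one_sub_exp_le μ ν hac (hψ n) (hψ_le n) fun x => ?_).trans
          (ENNReal.ofReal_le_ofReal (h (ψ n) n (hψ n) (hψ_le n)))
        rw [hexp_ψ]
        exact mul_log_expClamp_nonneg n (r x)
    _ = ENNReal.ofReal L := by simp

theorem klDiv_le_of_forall_boundedContinuous [TopologicalSpace α] [NormalSpace α] [BorelSpace α]
    (μ ν : Measure α) [IsProbabilityMeasure μ] [IsProbabilityMeasure ν] [(μ + ν).WeaklyRegular]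
    {L : ℝ} (h : ∀ φ : BoundedContinuousFunction α ℝ,
      ∫ x, φ x ∂μ - Real.log (∫ x, Real.exp (φ x) ∂ν) ≤ L) :
    klDiv μ ν ≤ ENNReal.ofReal L :=
  klDiv_le_of_forall_integral_sub_log_integral_exp_le μ ν fun _ _ hf hC =>
    integral_sub_log_integral_exp_le_of_forall_boundedContinuous μ ν h hf hC

end Entropy

section Sphere

theorem lintegral_Ioi_mul_eq_lintegral_sqrt_sub (a : ℝ) (K : ℝ → ℝ≥0∞) :
    ∫⁻ t in Set.Ioi (0 : ℝ), ENNReal.ofReal t * K t =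
      2⁻¹ * ∫⁻ s in Set.Ioi a, K √(s - a) := by
  have himage : (fun t : ℝ => a + t ^ 2) '' Set.Ioi 0 = Set.Ioi a := by
    ext s
    refine ⟨?_, fun hs => ⟨√(s - a), Real.sqrt_pos.2 (sub_pos.2 hs), ?_⟩⟩
    · rintro ⟨t, ht, rfl⟩
      exact lt_add_of_pos_right a (pow_pos ht 2)
    · simp [Real.sq_sqrt (sub_pos.2 hs).le]
  have hinj : Set.InjOn (fun t : ℝ => a + t ^ 2) (Set.Ioi 0) := fun x hx y hy hxy =>
    (sq_eq_sq₀ (le_of_lt hx) (le_of_lt hy)).1 (add_left_cancel hxy)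
  have hsubst := lintegral_image_eq_lintegral_abs_deriv_mul measurableSet_Ioi
    (f' := fun t => 2 * t) (fun x _ => by
      simpa using ((hasDerivAt_pow 2 x).const_add a).hasDerivWithinAt) hinj fun s => K √(s - a)
  rw [himage] at hsubst
  rw [hsubst, ← lintegral_const_mul' _ _ (by simp)]
  refine setLIntegral_congr_fun measurableSet_Ioi fun t (ht : 0 < t) => ?_
  rw [add_sub_cancel_left, Real.sqrt_sq ht.le, abs_of_pos (by positivity),
    ENNReal.ofReal_mul zero_le_two, ENNReal.ofReal_ofNat, ← mul_assoc, ← mul_assoc,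
    ENNReal.inv_mul_cancel (by simp) (by simp), one_mul]

theorem lintegral_eq_lintegral_Ioi_add_comp_neg {f : ℝ → ℝ≥0∞} (hf : Measurable f) :
    ∫⁻ t, f t = ∫⁻ t in Set.Ioi (0 : ℝ), (f t + f (-t)) := by
  rw [lintegral_add_left hf, ← lintegral_add_compl f (measurableSet_Ioi (a := (0 : ℝ))),
    Set.compl_Ioi, setLIntegral_congr Iio_ae_eq_Iic.symm]
  congr 1
  have h := (Measure.measurePreserving_neg (volume : Measure ℝ)).setLIntegral_comp_preimage
    (measurableSet_Iio (a := (0 : ℝ))) hf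
  simpa using h.symm

theorem lintegral_abs_mul_eq_lintegral_sqrt_sub (a : ℝ) {K : ℝ → ℝ≥0∞} (hK : Measurable K) :
    ∫⁻ t, ENNReal.ofReal |t| * K t =
      2⁻¹ * ∫⁻ s in Set.Ioi a, (K √(s - a) + K (-√(s - a))) := by
  rw [lintegral_eq_lintegral_Ioi_add_comp_neg (by fun_prop),
    ← lintegral_Ioi_mul_eq_lintegral_sqrt_sub a fun t => K t + K (-t)]
  refine setLIntegral_congr_fun measurableSet_Ioi fun t (ht : 0 < t) => ?_
  simp only [abs_neg, abs_of_pos ht, mul_add]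

theorem lintegral_eq_lintegral_toSphere {E : Type*} [NormedAddCommGroup E] [NormedSpace ℝ E]
    [MeasurableSpace E] [BorelSpace E] [FiniteDimensional ℝ E] [Nontrivial E] (μ : Measure E)
    [μ.IsAddHaarMeasure] {f : E → ℝ≥0∞} (hf : Measurable f) :
    ∫⁻ x, f x ∂μ = ∫⁻ ω : Metric.sphere (0 : E) 1, (∫⁻ r in Set.Ioi (0 : ℝ),
      ENNReal.ofReal (r ^ (Module.finrank ℝ E - 1)) * f (r • (ω : E))) ∂μ.toSphere := by
  have hmp := (μ.measurePreserving_homeomorphUnitSphereProd).symm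
    (homeomorphUnitSphereProd E).toMeasurableEquiv
  have hne_zero : ∫⁻ x, f x ∂μ = ∫⁻ x : ({0}ᶜ : Set E), f x ∂(μ.comap (↑)) := by
    rw [lintegral_subtype_comap (measurableSet_singleton (0 : E)).compl,
      restrict_compl_singleton]
  have hf' : Measurable fun x : ({0}ᶜ : Set E) => f x := hf.comp measurable_subtype_coe
  rw [hne_zero, ← hmp.lintegral_comp hf', lintegral_prod]
  swap
  · exact (hf'.comp (homeomorphUnitSphereProd E).symm.measurable).aemeasurable
  refine lintegral_congr fun ω => ?_
  rw [Measure.volumeIoiPow, lintegral_withDensity_eq_lintegral_mul]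
  · rw [← lintegral_subtype_comap measurableSet_Ioi]
    rfl
  · fun_prop
  · exact hf'.comp ((homeomorphUnitSphereProd E).symm.measurable.comp measurable_prodMk_left)

theorem lintegral_comp_smul_pi {n : ℕ} {c : ℝ} (hc : 0 < c) {f : (Fin n → ℝ) → ℝ≥0∞}
    (hf : Measurable f) :
    ∫⁻ y, f (c • y) = ENNReal.ofReal ((c ^ n)⁻¹) * ∫⁻ y, f y := by
  have h := Measure.map_addHaar_smul (volume : Measure (Fin n → ℝ)) hc.ne'
  rw [← lintegral_map hf (measurable_const_smul c), h, lintegral_smul_measure]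
  simp [abs_of_pos hc]

/-- The squared Euclidean norm (twice the kinetic energy) of `y : Fin n → ℝ`, whose norm as a
function is the supremum norm. -/
def sqSum {n : ℕ} (y : Fin n → ℝ) : ℝ := ∑ i, y i ^ 2

@[fun_prop]
theorem measurable_sqSum {n : ℕ} : Measurable (sqSum (n := n)) := by
  unfold sqSum
  fun_prop

theorem sqSum_nonneg {n : ℕ} (y : Fin n → ℝ) : 0 ≤ sqSum y :=
  Finset.sum_nonneg fun _ _ => sq_nonneg _

theorem sqSum_smul {n : ℕ} (c : ℝ) (y : Fin n → ℝ) : sqSum (c • y) = c ^ 2 * sqSum y := by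
  simp [sqSum, mul_pow, Finset.mul_sum]

theorem sqSum_cons {n : ℕ} (t : ℝ) (y : Fin n → ℝ) :
    sqSum (Fin.cons t y : Fin (n + 1) → ℝ) = t ^ 2 + sqSum y := by
  simp [sqSum, Fin.sum_univ_succ]

theorem sqSum_ofLp {n : ℕ} (x : EuclideanSpace ℝ (Fin n)) : sqSum x.ofLp = ‖x‖ ^ 2 := by
  simp [sqSum, EuclideanSpace.norm_sq_eq]

theorem measurableSet_sqSum_lt {n : ℕ} (R : ℝ) : MeasurableSet {y : Fin n → ℝ | sqSum y < R} :=
  measurableSet_lt measurable_sqSum measurable_const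

/-- The sum of `Ψ` over the two points of the sphere `{x | sqSum x = R}` that lie above `y` with
respect to the projection forgetting the first coordinate. -/
noncomputable def fiberSum (R : ℝ) {n : ℕ} (Ψ : (Fin (n + 1) → ℝ) → ℝ≥0∞) (y : Fin n → ℝ) :
    ℝ≥0∞ :=
  Ψ (Fin.cons √(R - sqSum y) y) + Ψ (Fin.cons (-√(R - sqSum y)) y)

@[fun_prop]
theorem measurable_cons {n : ℕ} :
    Measurable fun p : ℝ × (Fin n → ℝ) => (Fin.cons p.1 p.2 : Fin (n + 1) → ℝ) := by
  refine measurable_pi_lambda _ fun i => ?_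
  cases i using Fin.cases with
  | zero => simpa using measurable_fst
  | succ i =>
    simp only [Fin.cons_succ]
    fun_prop

theorem measurable_fiberSum (R : ℝ) {n : ℕ} {Ψ : (Fin (n + 1) → ℝ) → ℝ≥0∞}
    (hΨ : Measurable Ψ) : Measurable (fiberSum R Ψ) := by
  have hsqrt : Measurable fun y : Fin n → ℝ => √(R - sqSum y) := by fun_prop
  exact (hΨ.comp (measurable_cons.comp (hsqrt.prodMk measurable_id))).add
    (hΨ.comp (measurable_cons.comp (hsqrt.neg.prodMk measurable_id)))

theorem fiberSum_smul {c : ℝ} (hc : 0 ≤ c) (R : ℝ) {n : ℕ} (Ψ : (Fin (n + 1) → ℝ) → ℝ≥0∞)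
    (y : Fin n → ℝ) : fiberSum (c ^ 2 * R) Ψ (c • y) = fiberSum R (fun x => Ψ (c • x)) y := by
  have hsqrt : √(c ^ 2 * R - sqSum (c • y)) = c * √(R - sqSum y) := by
    rw [sqSum_smul, ← mul_sub, Real.sqrt_mul (sq_nonneg c), Real.sqrt_sq hc]
  have hcons : ∀ t : ℝ, (Fin.cons (c * t) (c • y) : Fin (n + 1) → ℝ) =
      c • (Fin.cons t y : Fin (n + 1) → ℝ) := fun t => by
    ext i
    cases i using Fin.cases <;> simp
  simp only [fiberSum, hsqrt, ← mul_neg, hcons]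

theorem setLIntegral_fiberSum_comp_smul {c : ℝ} (hc : 0 < c) (R : ℝ) {n : ℕ}
    {Ψ : (Fin (n + 1) → ℝ) → ℝ≥0∞} (hΨ : Measurable Ψ) :
    ∫⁻ y in {y : Fin n → ℝ | sqSum y < R}, fiberSum R (fun x => Ψ (c • x)) y =
      ENNReal.ofReal (c ^ n)⁻¹ *
        ∫⁻ y in {y : Fin n → ℝ | sqSum y < c ^ 2 * R}, fiberSum (c ^ 2 * R) Ψ y := by
  rw [← lintegral_indicator (measurableSet_sqSum_lt _),
    ← lintegral_indicator (measurableSet_sqSum_lt _),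
    ← lintegral_comp_smul_pi hc ((measurable_fiberSum _ hΨ).indicator (measurableSet_sqSum_lt _))]
  refine lintegral_congr fun y => ?_
  have hy : sqSum (c • y) < c ^ 2 * R ↔ sqSum y < R := by
    rw [sqSum_smul, mul_lt_mul_iff_right₀ (by positivity)]
  simp [Set.indicator, hy, fiberSum_smul hc.le]

theorem lintegral_pi_cons (ν : Measure ℝ) [SigmaFinite ν] {n : ℕ}
    {F : (Fin (n + 1) → ℝ) → ℝ≥0∞} (hF : Measurable F) :
    ∫⁻ x, F x ∂(Measure.pi fun _ => ν) =
      ∫⁻ y, ∫⁻ t, F (Fin.cons t y) ∂ν ∂(Measure.pi fun _ => ν) := by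
  rw [← ((measurePreserving_piFinSuccAbove (fun _ => ν) 0).symm _).lintegral_comp hF,
    lintegral_prod_symm']
  · simp [MeasurableEquiv.piFinSuccAbove, Fin.insertNthEquiv]
  · exact hF.comp (MeasurableEquiv.measurable _)

theorem lintegral_abs_apply_zero_mul {n : ℕ} {G : (Fin (n + 1) → ℝ) → ℝ≥0∞} (hG : Measurable G) :
    ∫⁻ x, ENNReal.ofReal |x 0| * G x =
      2⁻¹ * ∫⁻ y : Fin n → ℝ, ∫⁻ s in Set.Ioi (sqSum y), fiberSum s G y := by
  rw [volume_pi, lintegral_pi_cons _ (by fun_prop), ← volume_pi,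
    ← lintegral_const_mul' _ _ (by simp)]
  refine lintegral_congr fun y => ?_
  simp only [Fin.cons_zero]
  exact lintegral_abs_mul_eq_lintegral_sqrt_sub (sqSum y)
    (hG.comp (measurable_cons.comp (measurable_id.prodMk measurable_const)))

/-- The extension of `Ψ` from the unit sphere to the open unit ball that is constant on rays,
set to `0` outside of the ball. -/
noncomputable def radialExtension {n : ℕ} (Ψ : (Fin n → ℝ) → ℝ≥0∞) (x : Fin n → ℝ) : ℝ≥0∞ :=
  if sqSum x < 1 then Ψ ((√(sqSum x))⁻¹ • x) else 0

theorem measurable_radialExtension {n : ℕ} {Ψ : (Fin n → ℝ) → ℝ≥0∞} (hΨ : Measurable Ψ) :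
    Measurable (radialExtension Ψ) :=
  Measurable.ite (measurable_sqSum measurableSet_Iio) (by fun_prop) measurable_const

theorem radialExtension_smul {n : ℕ} (Ψ : (Fin n → ℝ) → ℝ≥0∞) {r : ℝ} (hr : 0 < r)
    {x : Fin n → ℝ} (hx : sqSum x = 1) :
    radialExtension Ψ (r • x) = if r < 1 then Ψ x else 0 := by
  simp only [radialExtension, sqSum_smul, hx, mul_one, Real.sqrt_sq hr.le, inv_smul_smul₀ hr.ne',
    sq_lt_one_iff₀ hr.le]

theorem fiberSum_radialExtension {n : ℕ} (Ψ : (Fin (n + 1) → ℝ) → ℝ≥0∞) {s : ℝ} {y : Fin n → ℝ}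
    (hy : sqSum y < s) :
    fiberSum s (radialExtension Ψ) y = if s < 1 then fiberSum 1 Ψ ((√s)⁻¹ • y) else 0 := by
  have hs : 0 < s := (sqSum_nonneg y).trans_lt hy
  have hscale : fiberSum 1 Ψ ((√s)⁻¹ • y) = fiberSum s (fun x => Ψ ((√s)⁻¹ • x)) y := by
    rw [← fiberSum_smul (by positivity), inv_pow, Real.sq_sqrt hs.le, inv_mul_cancel₀ hs.ne']
  have hsq : √(s - sqSum y) ^ 2 + sqSum y = s := by
    rw [Real.sq_sqrt (sub_pos.2 hy).le, sub_add_cancel]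
  rw [hscale]
  split_ifs with h <;> simp [fiberSum, radialExtension, sqSum_cons, hsq, h]

theorem lintegral_abs_mul_radialExtension_eq_lintegral_toSphere {n : ℕ}
    {Ψ : (Fin (n + 1) → ℝ) → ℝ≥0∞} (hΨ : Measurable Ψ) :
    ∫⁻ x : Fin (n + 1) → ℝ, ENNReal.ofReal |x 0| * radialExtension Ψ x =
      (∫⁻ r in Set.Ioo (0 : ℝ) 1, ENNReal.ofReal (r ^ (n + 1))) *
        ∫⁻ ω : Metric.sphere (0 : EuclideanSpace ℝ (Fin (n + 1))) 1,
          ENNReal.ofReal |ω.1.ofLp 0| * Ψ ω.1.ofLp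
          ∂(volume : Measure (EuclideanSpace ℝ (Fin (n + 1)))).toSphere := by
  have hF : Measurable fun x : Fin (n + 1) → ℝ =>
      ENNReal.ofReal |x 0| * radialExtension Ψ x := by
    have := measurable_radialExtension hΨ
    fun_prop
  have hF' : Measurable fun x : EuclideanSpace ℝ (Fin (n + 1)) =>
      ENNReal.ofReal |x.ofLp 0| * radialExtension Ψ x.ofLp := hF.comp (WithLp.measurable_ofLp 2 _)
  rw [← (PiLp.volume_preserving_ofLp (Fin (n + 1))).lintegral_comp hF,
    lintegral_eq_lintegral_toSphere _ hF', ← lintegral_const_mul _ (by fun_prop)]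
  refine lintegral_congr fun ω => ?_
  have hω : sqSum ω.1.ofLp = 1 := by rw [sqSum_ofLp, norm_eq_of_mem_sphere, one_pow]
  rw [← lintegral_mul_const _ (by fun_prop), ← Set.Iio_inter_Ioi,
    ← setLIntegral_indicator measurableSet_Iio]
  refine setLIntegral_congr_fun measurableSet_Ioi fun r (hr : 0 < r) => ?_
  rw [WithLp.ofLp_smul, radialExtension_smul Ψ hr hω, finrank_euclideanSpace_fin,
    Nat.add_sub_cancel, Pi.smul_apply, smul_eq_mul, abs_mul, abs_of_pos hr,
    ENNReal.ofReal_mul hr.le]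
  by_cases h : r < 1
  · rw [Set.indicator_of_mem (show r ∈ Set.Iio 1 from h), if_pos h, pow_succ,
      ENNReal.ofReal_mul (by positivity)]
    ring
  · simp [h]

theorem lintegral_abs_mul_radialExtension_eq_lintegral_fiberSum {n : ℕ}
    {Ψ : (Fin (n + 1) → ℝ) → ℝ≥0∞} (hΨ : Measurable Ψ) :
    ∫⁻ x : Fin (n + 1) → ℝ, ENNReal.ofReal |x 0| * radialExtension Ψ x =
      2⁻¹ * (∫⁻ s in Set.Ioo (0 : ℝ) 1, ENNReal.ofReal (√s ^ n)) *
        ∫⁻ y in {y : Fin n → ℝ | sqSum y < 1}, fiberSum 1 Ψ y := by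
  have hball := measurableSet_sqSum_lt (n := n) 1
  set Φ := {y : Fin n → ℝ | sqSum y < 1}.indicator (fiberSum 1 Ψ) with hΦ
  have hΦm : Measurable Φ := (measurable_fiberSum 1 hΨ).indicator hball
  have hinner : ∀ y : Fin n → ℝ,
      ∫⁻ s in Set.Ioi (sqSum y), fiberSum s (radialExtension Ψ) y =
        ∫⁻ s in Set.Ioo (0 : ℝ) 1, Φ ((√s)⁻¹ • y) := fun y => by
    rw [← lintegral_indicator measurableSet_Ioi, ← lintegral_indicator measurableSet_Ioo]
    refine lintegral_congr fun s => ?_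
    have hmem : 0 < s → (sqSum ((√s)⁻¹ • y) < 1 ↔ sqSum y < s) := fun hs => by
      rw [sqSum_smul, inv_pow, Real.sq_sqrt hs.le, inv_mul_lt_iff₀ hs, mul_one]
    by_cases hy : sqSum y < s
    · have hs : 0 < s := (sqSum_nonneg y).trans_lt hy
      simp [Set.indicator, hΦ, hy, hs, hmem hs, fiberSum_radialExtension Ψ hy]
    · by_cases hs : 0 < s <;> simp [Set.indicator, hΦ, hy, hs, hmem]
  rw [lintegral_abs_apply_zero_mul (measurable_radialExtension hΨ), mul_assoc]
  simp_rw [hinner]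
  rw [lintegral_lintegral_swap (by fun_prop), ← lintegral_indicator hball,
    ← lintegral_mul_const _ (by fun_prop)]
  congr 1
  refine setLIntegral_congr_fun measurableSet_Ioo fun s hs => ?_
  rw [lintegral_comp_smul_pi (inv_pos.2 (Real.sqrt_pos.2 hs.1)) hΦm, inv_pow, inv_inv]

theorem lintegral_Ioo_pow_eq_lintegral_Ioo_sqrt_pow (n : ℕ) :
    ∫⁻ r in Set.Ioo (0 : ℝ) 1, ENNReal.ofReal (r ^ (n + 1)) =
      2⁻¹ * ∫⁻ s in Set.Ioo (0 : ℝ) 1, ENNReal.ofReal (√s ^ n) := by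
  have h := lintegral_Ioi_mul_eq_lintegral_sqrt_sub 0
    ((Set.Iio (1 : ℝ)).indicator fun t => ENNReal.ofReal (t ^ n))
  have hsqrt : ∀ s : ℝ, (Set.Iio (1 : ℝ)).indicator (fun t => ENNReal.ofReal (t ^ n)) √(s - 0) =
      (Set.Iio (1 : ℝ)).indicator (fun s => ENNReal.ofReal (√s ^ n)) s := fun s => by
    simp [Set.indicator, Real.sqrt_lt' one_pos]
  simp only [hsqrt, ← Set.indicator_mul_right] at h
  rw [setLIntegral_indicator measurableSet_Iio, setLIntegral_indicator measurableSet_Iio,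
    Set.Iio_inter_Ioi] at h
  rw [← h]
  refine setLIntegral_congr_fun measurableSet_Ioo fun r hr => ?_
  rw [pow_succ', ENNReal.ofReal_mul hr.1.le]

theorem lintegral_abs_mul_toSphere_eq_lintegral_fiberSum {n : ℕ}
    {Ψ : (Fin (n + 1) → ℝ) → ℝ≥0∞} (hΨ : Measurable Ψ) :
    ∫⁻ ω : Metric.sphere (0 : EuclideanSpace ℝ (Fin (n + 1))) 1,
        ENNReal.ofReal |ω.1.ofLp 0| * Ψ ω.1.ofLp
        ∂(volume : Measure (EuclideanSpace ℝ (Fin (n + 1)))).toSphere =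
      ∫⁻ y in {y : Fin n → ℝ | sqSum y < 1}, fiberSum 1 Ψ y := by
  have hne_zero : ∫⁻ r in Set.Ioo (0 : ℝ) 1, ENNReal.ofReal (r ^ (n + 1)) ≠ 0 := by
    rw [← pos_iff_ne_zero, setLIntegral_pos_iff (by fun_prop)]
    refine lt_of_lt_of_le (by simp) (measure_mono (?_ : Set.Ioo (0 : ℝ) 1 ⊆ _))
    intro r hr
    simp [hr, hr.1]
  have hne_top : ∫⁻ r in Set.Ioo (0 : ℝ) 1, ENNReal.ofReal (r ^ (n + 1)) ≠ ∞ := by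
    refine ((setLIntegral_mono' measurableSet_Ioo fun r hr => ?_).trans_lt
      (by simp : ∫⁻ _ in Set.Ioo (0 : ℝ) 1, 1 < ∞)).ne
    simpa using pow_le_one₀ hr.1.le hr.2.le
  refine (ENNReal.mul_right_inj hne_zero hne_top).1 ?_
  rw [← lintegral_abs_mul_radialExtension_eq_lintegral_toSphere hΨ,
    lintegral_abs_mul_radialExtension_eq_lintegral_fiberSum hΨ,
    lintegral_Ioo_pow_eq_lintegral_Ioo_sqrt_pow]

instance isProbabilityMeasure_unif (n : ℕ) : IsProbabilityMeasure (unif (n + 1)) := by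
  refine ⟨?_⟩
  rw [unif, Measure.smul_apply, Measure.map_apply (by unfold dilate; fun_prop) MeasurableSet.univ,
    Set.preimage_univ, smul_eq_mul, ENNReal.inv_mul_cancel
      (Measure.measure_univ_ne_zero.2 (Measure.toSphere_ne_zero _)) (measure_ne_top _ _)]

theorem measurable_dilate (N : ℕ) : Measurable (dilate N) := by
  unfold dilate
  fun_prop

theorem lintegral_unif {N : ℕ} {f : KacSphere N → ℝ≥0∞} (hf : Measurable f) :
    ∫⁻ v, f v ∂(unif N) =
      ((volume : Measure (EuclideanSpace ℝ (Fin N))).toSphere Set.univ)⁻¹ *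
        ∫⁻ ω, f (dilate N ω) ∂(volume : Measure (EuclideanSpace ℝ (Fin N))).toSphere := by
  rw [unif, lintegral_smul_measure, lintegral_map hf (measurable_dilate N), smul_eq_mul]

theorem ae_toSphere_coord_ne_zero {n : ℕ} (i : Fin n) :
    ∀ᵐ ω ∂(volume : Measure (EuclideanSpace ℝ (Fin n))).toSphere, ω.1.ofLp i ≠ 0 := by
  have hmeas : MeasurableSet {ω : Metric.sphere (0 : EuclideanSpace ℝ (Fin n)) 1 |
      ω.1.ofLp i = 0} := measurableSet_eq_fun (by fun_prop) measurable_const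
  have hplane : (volume : Measure (EuclideanSpace ℝ (Fin n))) {x | x.ofLp i = 0} = 0 := by
    exact ((PiLp.volume_preserving_ofLp (Fin n)).measure_preimage
      (measurable_pi_apply i (measurableSet_singleton 0)).nullMeasurableSet).trans
      (Measure.pi_hyperplane _ i 0)
  simp only [ae_iff, not_not]
  rw [Measure.toSphere_apply' _ hmeas, measure_mono_null ?_ hplane, mul_zero]
  rintro _ ⟨r, -, _, ⟨ω, hω, rfl⟩, rfl⟩
  simp_all

theorem ae_unif_coord_ne_zero {n : ℕ} (i : Fin (n + 1)) :
    ∀ᵐ v ∂(unif (n + 1)), v.1.ofLp i ≠ 0 := by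
  refine Measure.ae_smul_measure ((ae_map_iff (measurable_dilate _).aemeasurable
    (measurableSet_eq_fun (by fun_prop) measurable_const).compl).2 ?_) _
  filter_upwards [ae_toSphere_coord_ne_zero i] with ω hω
  have : √(n + 1 : ℝ) ≠ 0 := by positivity
  simp [dilate, hω, this]

/-- The factor relating `|v 0| dσ^{n+1}(v)` to Lebesgue measure on the ball of radius `√(n + 1)`. -/
noncomputable def sliceConst (n : ℕ) : ℝ≥0∞ :=
  ((volume : Measure (EuclideanSpace ℝ (Fin (n + 1)))).toSphere Set.univ)⁻¹ *
    ENNReal.ofReal (√(n + 1) / √(n + 1) ^ n)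

theorem sliceConst_ne_zero (n : ℕ) : sliceConst n ≠ 0 := by
  have hpos : 0 < √(n + 1 : ℝ) / √(n + 1) ^ n := by positivity
  exact mul_ne_zero (ENNReal.inv_ne_zero.2 (measure_ne_top _ _)) (ENNReal.ofReal_pos.2 hpos).ne'

theorem sliceConst_ne_top (n : ℕ) : sliceConst n ≠ ∞ :=
  ENNReal.mul_ne_top (ENNReal.inv_ne_top.2
    (Measure.measure_univ_ne_zero.2 (Measure.toSphere_ne_zero _))) ENNReal.ofReal_ne_top

theorem lintegral_abs_mul_unif_eq_lintegral_fiberSum {n : ℕ} {Ψ : (Fin (n + 1) → ℝ) → ℝ≥0∞}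
    (hΨ : Measurable Ψ) :
    ∫⁻ v, ENNReal.ofReal |v.1.ofLp 0| * Ψ v.1.ofLp ∂(unif (n + 1)) =
      sliceConst n * ∫⁻ y in {y : Fin n → ℝ | sqSum y < n + 1}, fiberSum (n + 1) Ψ y := by
  set c := √(n + 1 : ℝ) with hc
  have hc_pos : 0 < c := by positivity
  have hc_sq : c ^ 2 = n + 1 := Real.sq_sqrt (by positivity)
  have hdilate : ∀ ω, (dilate (n + 1) ω).1.ofLp = c • ω.1.ofLp := fun ω => by
    simp [dilate, hc]
  have hmeas : Measurable fun v : KacSphere (n + 1) =>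
      ENNReal.ofReal |v.1.ofLp 0| * Ψ v.1.ofLp :=
    Measurable.mul (by fun_prop)
      (hΨ.comp ((WithLp.measurable_ofLp 2 _).comp measurable_subtype_coe))
  have hball := setLIntegral_fiberSum_comp_smul hc_pos 1 hΨ
  rw [hc_sq, mul_one] at hball
  rw [lintegral_unif hmeas, sliceConst, mul_assoc]
  congr 1
  simp only [hdilate, Pi.smul_apply, smul_eq_mul, abs_mul, abs_of_pos hc_pos,
    ENNReal.ofReal_mul hc_pos.le, mul_assoc]
  rw [lintegral_const_mul' _ _ ENNReal.ofReal_ne_top,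
    lintegral_abs_mul_toSphere_eq_lintegral_fiberSum (Ψ := fun x => Ψ (c • x)) (by fun_prop),
    hball, div_eq_mul_inv, ENNReal.ofReal_mul hc_pos.le, mul_assoc]

end Sphere

section Energy

theorem lintegral_prod_pi (ν : Measure ℝ) [SigmaFinite ν] {n : ℕ} {f : Fin n → ℝ → ℝ≥0∞}
    (hf : ∀ i, Measurable (f i)) :
    ∫⁻ y, ∏ i, f i (y i) ∂(Measure.pi fun _ => ν) = ∏ i, ∫⁻ t, f i t ∂ν := by
  induction n with
  | zero => simp
  | succ n ih =>
    rw [lintegral_pi_cons ν (by fun_prop), Fin.prod_univ_succ, ← ih fun i => hf i.succ,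
      ← lintegral_const_mul _ (by fun_prop)]
    refine lintegral_congr fun y => ?_
    simp only [Fin.prod_univ_succ, Fin.cons_zero, Fin.cons_succ]
    rw [lintegral_mul_const _ (hf 0)]

theorem pi_withDensity (ν : Measure ℝ) [SigmaFinite ν] {f : ℝ → ℝ≥0∞} (hf : Measurable f)
    [SigmaFinite (ν.withDensity f)] (n : ℕ) :
    Measure.pi (fun _ : Fin n => ν.withDensity f) =
      (Measure.pi fun _ => ν).withDensity fun y => ∏ i, f (y i) := by
  refine Measure.pi_eq fun s hs => ?_
  have hprod : ∀ y : Fin n → ℝ, (Set.univ.pi s).indicator (fun y => ∏ i, f (y i)) y =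
      ∏ i, (s i).indicator f (y i) := fun y => by
    classical
    simp only [Set.indicator_apply, Finset.prod_ite_zero, Set.mem_univ_pi, Finset.mem_univ,
      true_imp_iff]
  rw [withDensity_apply _ (MeasurableSet.univ_pi hs),
    ← lintegral_indicator (MeasurableSet.univ_pi hs), lintegral_congr hprod,
    lintegral_prod_pi ν fun i => hf.indicator (hs i)]
  refine Finset.prod_congr rfl fun i _ => ?_
  rw [lintegral_indicator (hs i), withDensity_apply _ (hs i)]

variable {g : ℝ → ℝ}

instance sigmaFinite_densityMeasure : SigmaFinite (densityMeasure g) :=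
  SigmaFinite.withDensity_of_ne_top (ae_of_all _ fun _ => ENNReal.ofReal_ne_top)

theorem isProbabilityMeasure_densityMeasure (hg0 : ∀ x, 0 ≤ g x) (h1 : ∫ x, g x = 1) :
    IsProbabilityMeasure (densityMeasure g) := by
  have hi : Integrable g := Integrable.of_integral_ne_zero (by simp [h1])
  refine ⟨?_⟩
  rw [densityMeasure, withDensity_apply _ MeasurableSet.univ, setLIntegral_univ,
    ← ofReal_integral_eq_lintegral_ofReal hi (ae_of_all _ hg0), h1, ENNReal.ofReal_one]

/-- The density of the law of the energy `v ^ 2` when `v` has density `g`. -/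
noncomputable def sqDensity (g : ℝ → ℝ) (s : ℝ) : ℝ≥0∞ :=
  if 0 < s then 2⁻¹ * ((ENNReal.ofReal (g √s) + ENNReal.ofReal (g (-√s))) / ENNReal.ofReal √s)
  else 0

theorem two_mul_sqDensity {s : ℝ} (hs : 0 < s) :
    2 * sqDensity g s =
      (ENNReal.ofReal (g √s) + ENNReal.ofReal (g (-√s))) / ENNReal.ofReal √s := by
  rw [sqDensity, if_pos hs, ← mul_assoc, ENNReal.mul_inv_cancel two_ne_zero ENNReal.ofNat_ne_top,
    one_mul]

theorem measurable_sqDensity (hg : Measurable g) : Measurable (sqDensity g) :=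
  Measurable.ite measurableSet_Ioi (by fun_prop) measurable_const

theorem lintegral_comp_sub_sq (hg : Measurable g) {F : ℝ → ℝ≥0∞} (hF : Measurable F) (w : ℝ) :
    ∫⁻ v, F (w - v ^ 2) ∂(densityMeasure g) = (sqDensity g ⋆ₗ F) w := by
  have hweight : ∀ᵐ v : ℝ, ENNReal.ofReal (g v) * F (w - v ^ 2) = ENNReal.ofReal |v| *
      (ENNReal.ofReal (g v) / ENNReal.ofReal |v| * F (w - v ^ 2)) := by
    filter_upwards [Measure.ae_ne volume 0] with v hv
    rw [← mul_assoc, ENNReal.mul_div_cancel (by simpa using hv) ENNReal.ofReal_ne_top]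
  rw [densityMeasure, lintegral_withDensity_eq_lintegral_mul _ (by fun_prop) (by fun_prop)]
  simp only [Pi.mul_apply]
  rw [lintegral_congr_ae hweight, lintegral_abs_mul_eq_lintegral_sqrt_sub 0 (by fun_prop),
    ← lintegral_const_mul' _ _ (by simp), lconvolution_def, ← lintegral_indicator measurableSet_Ioi]
  refine lintegral_congr fun s => ?_
  by_cases hs : 0 < s
  · simp only [Set.indicator, Set.mem_Ioi, hs, if_true, sqDensity, sub_zero, neg_sq, abs_neg,
      Real.sq_sqrt hs.le, abs_of_nonneg (Real.sqrt_nonneg s), neg_add_eq_sub]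
    rw [← add_mul, ENNReal.div_add_div_same, mul_assoc]
  · simp [sqDensity, hs]

theorem lintegral_sqDensity_mul (hg : Measurable g) {F : ℝ → ℝ≥0∞} (hF : Measurable F) :
    ∫⁻ s, sqDensity g s * F s = ∫⁻ v, F (v ^ 2) ∂(densityMeasure g) := by
  have h := lintegral_comp_sub_sq hg (hF.comp measurable_neg) 0
  simpa [lconvolution_def] using h.symm

/-- The convolution power of `h` with `n + 1` factors. -/
noncomputable def lconvPow (h : ℝ → ℝ≥0∞) : ℕ → ℝ → ℝ≥0∞
  | 0 => h
  | n + 1 => h ⋆ₗ lconvPow h n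

variable {h : ℝ → ℝ≥0∞}

@[fun_prop]
theorem measurable_lconvPow (hh : Measurable h) : ∀ n, Measurable (lconvPow h n)
  | 0 => hh
  | n + 1 => measurable_lconvolution _ hh (measurable_lconvPow hh n)

theorem lconvPow_lconvolution_lconvPow (hh : Measurable h) (m n : ℕ) :
    lconvPow h m ⋆ₗ lconvPow h n = lconvPow h (m + n + 1) := by
  induction m with
  | zero => rw [zero_add]; rfl
  | succ m ih =>
    rw [lconvPow, ← lconvolution_assoc hh (measurable_lconvPow hh m) (measurable_lconvPow hh n),
      ih, Nat.add_right_comm m 1 n]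
    rfl

theorem lconvPow_lconvPow (hh : Measurable h) (m j : ℕ) :
    lconvPow (lconvPow h m) j = lconvPow h ((m + 1) * j + m) := by
  induction j with
  | zero => simp [lconvPow]
  | succ j ih =>
    rw [lconvPow, ih, lconvPow_lconvolution_lconvPow hh]
    congr 1
    ring

theorem lintegral_lconvPow_sub_sqSum (hg : Measurable g) (j n : ℕ) (w : ℝ) :
    ∫⁻ y : Fin n → ℝ, lconvPow (sqDensity g) j (w - sqSum y)
      ∂(Measure.pi fun _ => densityMeasure g) = lconvPow (sqDensity g) (n + j) w := by
  have hh := measurable_sqDensity hg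
  induction n generalizing j with
  | zero => simp [sqSum]
  | succ n ih =>
    rw [lintegral_pi_cons _ (by fun_prop), Nat.add_right_comm, add_assoc n, ← ih]
    refine lintegral_congr fun y => ?_
    simp only [sqSum_cons, add_comm _ (sqSum y), ← sub_sub]
    exact lintegral_comp_sub_sq hg (measurable_lconvPow hh j) _

theorem lintegral_tensorDensity_mul_unif (hg : Measurable g) {n : ℕ} {W : (Fin n → ℝ) → ℝ≥0∞}
    (hW : Measurable W) :
    ∫⁻ v, tensorDensity g (n + 1) v * W (Fin.tail v.1.ofLp) ∂(unif (n + 1)) =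
      2 * sliceConst n * ∫⁻ y, sqDensity g (n + 1 - sqSum y) * W y
        ∂(Measure.pi fun _ => densityMeasure g) := by
  have hh := measurable_sqDensity hg
  have htail : Measurable fun x : Fin (n + 1) → ℝ => Fin.tail x :=
    measurable_pi_lambda _ fun i => measurable_pi_apply i.succ
  set Ψ : (Fin (n + 1) → ℝ) → ℝ≥0∞ := fun x =>
    (∏ j, ENNReal.ofReal (g (x j))) / ENNReal.ofReal |x 0| * W (Fin.tail x) with hΨ
  have hΨ_meas : Measurable Ψ := by fun_prop
  have hweight : ∀ᵐ v ∂(unif (n + 1)), tensorDensity g (n + 1) v * W (Fin.tail v.1.ofLp) =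
      ENNReal.ofReal |v.1.ofLp 0| * Ψ v.1.ofLp := by
    filter_upwards [ae_unif_coord_ne_zero 0] with v hv
    rw [hΨ, ← mul_assoc, ENNReal.mul_div_cancel (by simpa using hv) ENNReal.ofReal_ne_top]
    rfl
  have hfiber : ∀ y : Fin n → ℝ, {y | sqSum y < n + 1}.indicator (fiberSum (n + 1) Ψ) y =
      2 * ((∏ j, ENNReal.ofReal (g (y j))) * (sqDensity g (n + 1 - sqSum y) * W y)) := fun y => by
    by_cases hy : sqSum y < n + 1
    · simp only [Set.indicator_of_mem (show y ∈ {y | sqSum y < n + 1} from hy), fiberSum, hΨ,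
        Fin.prod_univ_succ, Fin.cons_zero, Fin.cons_succ, Fin.tail_cons, abs_neg,
        abs_of_nonneg (Real.sqrt_nonneg _)]
      rw [← add_mul, ENNReal.div_add_div_same, ← add_mul, ENNReal.mul_div_right_comm,
        ← two_mul_sqDensity (sub_pos.2 hy)]
      ring
    · simp [sqDensity, hy]
  rw [lintegral_congr_ae hweight, lintegral_abs_mul_unif_eq_lintegral_fiberSum hΨ_meas,
    ← lintegral_indicator (measurableSet_sqSum_lt _), lintegral_congr hfiber,
    lintegral_const_mul' _ _ ENNReal.ofNat_ne_top, mul_left_comm, mul_assoc, densityMeasure,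
    pi_withDensity volume (by fun_prop), ← volume_pi,
    lintegral_withDensity_eq_lintegral_mul _ (by fun_prop) (by fun_prop)]
  rfl

theorem Z_eq_lconvPow_sqDensity (hg : Measurable g) (n : ℕ) :
    Z g (n + 1) = 2 * sliceConst n * lconvPow (sqDensity g) n (n + 1) := by
  have h := lintegral_tensorDensity_mul_unif hg (n := n) (W := fun _ => 1) measurable_const
  simp only [mul_one] at h
  rw [Z, h, ← add_zero n, ← lintegral_lconvPow_sub_sqSum hg, add_zero]
  rfl

end Energy

section LowerBound

theorem le_lconvolution {f F : ℝ → ℝ≥0∞} {a b ρ R : ℝ} {α δ : ℝ≥0∞} (hρ : 0 < ρ) (hR : ρ ≤ R)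
    (hf : ∀ s, |s - b| ≤ ρ → δ ≤ f s) (hF : ∀ s, |s - a| ≤ R → α ≤ F s) {w : ℝ}
    (hw : |w - (a + b)| ≤ R + ρ / 2) :
    α * (δ * ENNReal.ofReal (ρ / 2)) ≤ (f ⋆ₗ F) w := by
  obtain ⟨c, hc⟩ : ∃ c, ∀ s ∈ Set.Icc c (c + ρ / 2), |s - b| ≤ ρ ∧ |-s + w - a| ≤ R := by
    rw [abs_le] at hw
    rcases le_total (a + b) w with h | h
    · exact ⟨b + ρ / 2, fun s ⟨h1, h2⟩ =>
        ⟨abs_le.2 ⟨by linarith, by linarith⟩, abs_le.2 ⟨by linarith, by linarith⟩⟩⟩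
    · exact ⟨b - ρ, fun s ⟨h1, h2⟩ =>
        ⟨abs_le.2 ⟨by linarith, by linarith⟩, abs_le.2 ⟨by linarith, by linarith⟩⟩⟩
  calc α * (δ * ENNReal.ofReal (ρ / 2)) = ∫⁻ _ in Set.Icc c (c + ρ / 2), δ * α := by
        rw [setLIntegral_const, Real.volume_Icc, add_sub_cancel_left]
        ring
    _ ≤ ∫⁻ s in Set.Icc c (c + ρ / 2), f s * F (-s + w) :=
        setLIntegral_mono' measurableSet_Icc fun s hs =>
          mul_le_mul' (hf s (hc s hs).1) (hF _ (hc s hs).2)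
    _ ≤ (f ⋆ₗ F) w := setLIntegral_le_lintegral _ _

theorem le_lconvPow {f : ℝ → ℝ≥0∞} {b ρ : ℝ} {δ : ℝ≥0∞} (hρ : 0 < ρ)
    (hf : ∀ s, |s - b| ≤ ρ → δ ≤ f s) (j : ℕ) {w : ℝ} (hw : |w - (j + 1) * b| ≤ ρ + j * (ρ / 2)) :
    δ * (δ * ENNReal.ofReal (ρ / 2)) ^ j ≤ lconvPow f j w := by
  induction j generalizing w with
  | zero => simpa [lconvPow] using hf w (by simpa using hw)
  | succ j ih =>
    rw [pow_succ, ← mul_assoc]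
    refine le_lconvolution hρ (le_add_of_nonneg_right (by positivity)) hf (fun s hs => ih hs) ?_
    push_cast at hw
    convert hw using 1 <;> ring_nf

theorem exists_pos_measure_inter_lt {α : Type*} [MeasurableSpace α] {μ : Measure α}
    {f : α → ℝ≥0∞} (hf : Measurable f) {E : Set α} (hE : MeasurableSet E)
    (hpos : 0 < ∫⁻ x in E, f x ∂μ) : ∃ η > 0, 0 < μ (E ∩ {x | η < f x}) := by
  by_contra! hnull
  refine hpos.ne' ((setLIntegral_eq_zero_iff hE hf).2 ?_)
  have hae : ∀ᵐ x ∂μ, ∀ n : ℕ, x ∉ E ∩ {x | (n : ℝ≥0∞)⁻¹ < f x} := ae_all_iff.2 fun n =>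
    measure_eq_zero_iff_ae_notMem.1 (nonpos_iff_eq_zero.1 (hnull _ (by simp)))
  filter_upwards [hae] with x hx hxE
  by_contra hne
  obtain ⟨n, hn⟩ := ENNReal.exists_inv_nat_lt hne
  exact hx n ⟨hxE, hn⟩

theorem exists_mul_volume_closedBall_lt_volume_inter {D : Set ℝ} (hD : MeasurableSet D)
    (hpos : 0 < volume D) {c : ℝ≥0∞} (hc : c < 1) :
    ∃ x ∈ D, ∃ r > 0, c * volume (Metric.closedBall x r) < volume (D ∩ Metric.closedBall x r) := by
  have : (ae (volume.restrict D)).NeBot := by simpa using hpos.ne'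
  obtain ⟨x, hx, hxD⟩ := ((Besicovitch.ae_tendsto_measure_inter_div volume D).and
    (ae_restrict_mem hD)).exists
  obtain ⟨r, hr, hr_pos : 0 < r⟩ := ((hx.eventually_const_lt hc).and self_mem_nhdsWithin).exists
  refine ⟨x, hxD, r, hr_pos, ?_⟩
  exact (ENNReal.lt_div_iff_mul_lt (Or.inl (by simp [hr_pos]))
    (Or.inl (by simp [ENNReal.mul_eq_top]))).1 hr

theorem le_volume_inter_preimage_sub {B : Set ℝ} (hB : MeasurableSet B) {x r w : ℝ} (hr : 0 ≤ r)
    (hBx : B ⊆ Metric.closedBall x r) (hvol : ENNReal.ofReal (3 / 2 * r) ≤ volume B)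
    (hw : |w - 2 * x| ≤ r / 2) :
    ENNReal.ofReal (r / 2) ≤ volume (B ∩ (fun s => w - s) ⁻¹' B) := by
  set B' := (fun s => w - s) ⁻¹' B with hB'
  have hvol' : volume B' = volume B :=
    (Measure.measurePreserving_sub_left volume w).measure_preimage hB.nullMeasurableSet
  have hunion : volume (B ∪ B') ≤ ENNReal.ofReal (5 / 2 * r) := by
    refine (measure_mono (t := Metric.closedBall (w / 2) (5 / 4 * r)) ?_).trans ?_
    · have hsub : ∀ s ∈ B, |s - x| ≤ r := fun s hs => by simpa [Real.dist_eq] using hBx hs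
      rw [abs_le] at hw
      rintro s (hs | hs)
      all_goals
        have hs := abs_le.1 (hsub _ hs)
        rw [Metric.mem_closedBall, Real.dist_eq, abs_le]
        constructor <;> linarith
    · rw [Real.volume_closedBall]
      exact ENNReal.ofReal_le_ofReal (by linarith)
  refine (ENNReal.add_le_add_iff_left (ENNReal.ofReal_ne_top (r := 5 / 2 * r))).1 ?_
  calc ENNReal.ofReal (5 / 2 * r) + ENNReal.ofReal (r / 2)
      = ENNReal.ofReal (3 / 2 * r) + ENNReal.ofReal (3 / 2 * r) := by
        rw [← ENNReal.ofReal_add (by positivity) (by positivity),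
          ← ENNReal.ofReal_add (by positivity) (by positivity)]
        congr 1
        ring
    _ ≤ volume B + volume B' := add_le_add hvol (hvol.trans hvol'.ge)
    _ = volume (B ∪ B') + volume (B ∩ B') :=
        (measure_union_add_inter B (hB.preimage (by fun_prop))).symm
    _ ≤ ENNReal.ofReal (5 / 2 * r) + volume (B ∩ B') := by gcongr

variable {h : ℝ → ℝ≥0∞}

theorem exists_le_lconvolution_self (hh : Measurable h) {E : Set ℝ} (hE : MeasurableSet E)
    (hpos : 0 < ∫⁻ s in E, h s) :
    ∃ x ∈ E, ∃ ρ > 0, ∃ δ > 0, ∀ w, |w - 2 * x| ≤ ρ → δ ≤ (h ⋆ₗ h) w := by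
  obtain ⟨η, hη, hD_pos⟩ := exists_pos_measure_inter_lt hh hE hpos
  set D := E ∩ {s | η < h s}
  have hDm : MeasurableSet D := hE.inter (measurableSet_lt measurable_const hh)
  obtain ⟨x, hxD, r, hr, hvol⟩ := exists_mul_volume_closedBall_lt_volume_inter hDm hD_pos
    (c := ENNReal.ofReal (3 / 4)) (by rw [ENNReal.ofReal_lt_one]; norm_num)
  set B := D ∩ Metric.closedBall x r with hB
  have hBm : MeasurableSet B := hDm.inter Metric.isClosed_closedBall.measurableSet
  have hBvol : ENNReal.ofReal (3 / 2 * r) ≤ volume B := by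
    rw [Real.volume_closedBall, ← ENNReal.ofReal_mul (by norm_num)] at hvol
    exact hvol.le.trans' (ENNReal.ofReal_le_ofReal (by linarith))
  refine ⟨x, hxD.1, r / 2, by positivity, η * η * ENNReal.ofReal (r / 2), ?_, fun w hw => ?_⟩
  · have : 0 < ENNReal.ofReal (r / 2) := by simpa using hr
    positivity
  set B' := (fun s => w - s) ⁻¹' B
  calc η * η * ENNReal.ofReal (r / 2) ≤ η * η * volume (B ∩ B') := by
        gcongr
        exact le_volume_inter_preimage_sub hBm hr.le Set.inter_subset_right hBvol hw
    _ = ∫⁻ _ in B ∩ B', η * η := (setLIntegral_const _ _).symm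
    _ ≤ ∫⁻ s in B ∩ B', h s * h (-s + w) :=
        setLIntegral_mono' (hBm.inter (hBm.preimage (by fun_prop))) fun s hs =>
          mul_le_mul' hs.1.1.2.le (neg_add_eq_sub s w ▸ hs.2.1.2.le)
    _ ≤ (h ⋆ₗ h) w := setLIntegral_le_lintegral _ _

theorem exists_weights_near_mean {x y : ℝ} (hx : x < 1) (hy : 1 < y) (K : ℝ) :
    ∃ p q : ℕ, K ≤ q ∧
      |x * (p + 1) + y * (q + 1) - (p + q + 2)| ≤ (1 - x) + (y - 1) := by
  have ha : 0 < 1 - x := sub_pos.2 hx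
  have hb : 0 < y - 1 := sub_pos.2 hy
  set t := (1 + |K|) / (1 - x)
  have ht_pos : 0 < t := by positivity
  have hta : t * (1 - x) = 1 + |K| := div_mul_cancel₀ _ ha.ne'
  have hp := Nat.floor_le (mul_pos ht_pos hb).le
  have hp' := Nat.lt_floor_add_one (t * (y - 1))
  have hq := Nat.floor_le (mul_pos ht_pos ha).le
  have hq' := Nat.lt_floor_add_one (t * (1 - x))
  refine ⟨⌊t * (y - 1)⌋₊, ⌊t * (1 - x)⌋₊, by linarith [le_abs_self K], abs_le.2 ⟨?_, ?_⟩⟩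
  all_goals nlinarith

theorem exists_le_lconvPow_near_mean (hh : Measurable h) (hlow : 0 < ∫⁻ s in Set.Iio 1, h s)
    (hhigh : 0 < ∫⁻ s in Set.Ioi 1, h s) :
    ∃ n : ℕ, ∃ δ > 0, ∀ w : ℝ, |w - (n + 1)| ≤ 1 → δ ≤ lconvPow h n w := by
  obtain ⟨x, hx, ρ₁, hρ₁, δ₁, hδ₁, hx_le⟩ := exists_le_lconvolution_self hh measurableSet_Iio hlow
  obtain ⟨y, hy, ρ₂, hρ₂, δ₂, hδ₂, hy_le⟩ := exists_le_lconvolution_self hh measurableSet_Ioi hhigh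
  set ρ := min ρ₁ ρ₂
  have hρ : 0 < ρ := lt_min hρ₁ hρ₂
  have : 0 < ENNReal.ofReal (ρ / 2) := by simpa using hρ
  have hx_pow := le_lconvPow (f := lconvPow h 1) hρ
    fun s hs => hx_le s (hs.trans (min_le_left _ _))
  have hy_pow := le_lconvPow (f := lconvPow h 1) hρ
    fun s hs => hy_le s (hs.trans (min_le_right _ _))
  obtain ⟨p, q, hq, hmean⟩ := exists_weights_near_mean hx hy
    ((1 + 2 * ((1 - x) + (y - 1))) / (ρ / 2))
  rw [div_le_iff₀ (by positivity)] at hq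
  set α := δ₂ * (δ₂ * ENNReal.ofReal (ρ / 2)) ^ q with hα
  set β := δ₁ * (δ₁ * ENNReal.ofReal (ρ / 2)) ^ p with hβ
  refine ⟨2 * (p + q + 1) + 1, α * (β * ENNReal.ofReal (ρ / 2)), by positivity, fun w hw => ?_⟩
  have hpow : lconvPow h (2 * (p + q + 1) + 1) =
      lconvPow (lconvPow h 1) p ⋆ₗ lconvPow (lconvPow h 1) q := by
    rw [lconvPow_lconvolution_lconvPow (measurable_lconvPow hh 1), lconvPow_lconvPow hh]
  rw [hpow]
  refine le_lconvolution hρ (R := ρ + q * (ρ / 2)) (a := (q + 1) * (2 * y))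
    (b := (p + 1) * (2 * x)) (le_add_of_nonneg_right (by positivity))
    (fun s hs => hx_pow p (hs.trans (le_add_of_nonneg_right (by positivity))))
    (fun s hs => hy_pow q hs) ?_
  push_cast at hw
  rw [abs_le] at hw hmean ⊢
  constructor <;> linarith

end LowerBound

section LawOfLargeNumbers

variable {g : ℝ → ℝ}

theorem setLIntegral_sqDensity (hg : Measurable g) {A : Set ℝ} (hA : MeasurableSet A) :
    ∫⁻ s in A, sqDensity g s = densityMeasure g {v | v ^ 2 ∈ A} := by
  have h := lintegral_sqDensity_mul hg (measurable_one.indicator hA)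
  have hsq : MeasurableSet {v : ℝ | v ^ 2 ∈ A} := hA.preimage (by fun_prop)
  rw [← lintegral_indicator_one hsq, ← lintegral_indicator hA]
  refine Eq.trans (lintegral_congr fun s => ?_) h
  by_cases hs : s ∈ A <;> simp [hs]

theorem integrable_densityMeasure_iff (hg : Measurable g) (hg0 : ∀ x, 0 ≤ g x) {f : ℝ → ℝ} :
    Integrable f (densityMeasure g) ↔ Integrable fun x => g x * f x := by
  rw [densityMeasure, integrable_withDensity_iff_integrable_smul₀' (by fun_prop) (by simp)]
  simp [hg0]

theorem integral_densityMeasure (hg : Measurable g) (hg0 : ∀ x, 0 ≤ g x) (f : ℝ → ℝ) :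
    ∫ x, f x ∂(densityMeasure g) = ∫ x, g x * f x := by
  rw [densityMeasure, integral_withDensity_eq_integral_toReal_smul₀ (by fun_prop) (by simp)]
  simp [hg0]

theorem integrable_sq_densityMeasure (hg : Measurable g) (hg0 : ∀ x, 0 ≤ g x)
    (h2 : ∫ x, g x * x ^ 2 = 1) : Integrable (fun v => v ^ 2) (densityMeasure g) :=
  (integrable_densityMeasure_iff hg hg0).2 (Integrable.of_integral_ne_zero (by simp [h2]))

theorem setLIntegral_Iio_sqDensity_pos (hg : Measurable g) (hg0 : ∀ x, 0 ≤ g x)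
    [IsProbabilityMeasure (densityMeasure g)] (h2 : ∫ x, g x * x ^ 2 = 1) :
    0 < ∫⁻ s in Set.Iio 1, sqDensity g s := by
  have h := measure_le_integral_pos (integrable_sq_densityMeasure hg hg0 h2)
  rw [integral_densityMeasure hg hg0, h2] at h
  rwa [setLIntegral_congr Iio_ae_eq_Iic, setLIntegral_sqDensity hg measurableSet_Iic]

theorem setLIntegral_Ioi_sqDensity_pos (hg : Measurable g) (hg0 : ∀ x, 0 ≤ g x)
    [IsProbabilityMeasure (densityMeasure g)] (h2 : ∫ x, g x * x ^ 2 = 1) :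
    0 < ∫⁻ s in Set.Ioi 1, sqDensity g s := by
  have h := measure_integral_le_pos (integrable_sq_densityMeasure hg hg0 h2)
  rw [integral_densityMeasure hg hg0, h2] at h
  rwa [setLIntegral_congr Ioi_ae_eq_Ici, setLIntegral_sqDensity hg measurableSet_Ici]

theorem map_infinitePi_fin_eq_pi {α : Type*} [MeasurableSpace α] (ν : Measure α)
    [IsProbabilityMeasure ν] (n : ℕ) :
    (Measure.infinitePi fun _ : ℕ => ν).map (fun ω (i : Fin n) => ω i) =
      Measure.pi fun _ => ν := by
  have hindep : iIndepFun (fun (i : ℕ) (ω : ℕ → α) => ω i) (Measure.infinitePi fun _ : ℕ => ν) :=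
    iIndepFun_infinitePi (X := fun _ => id) fun _ => measurable_id
  have h := (iIndepFun_iff_map_fun_eq_pi_map (fun i => (measurable_pi_apply _).aemeasurable)).1
    (hindep.precomp (Fin.val_injective (n := n)))
  simpa only [Measure.infinitePi_map_eval, Function.comp_apply] using h

theorem tendsto_pi_lt_abs_sum_sub_mul_integral {α : Type*} [MeasurableSpace α] (ν : Measure α)
    [IsProbabilityMeasure ν] {f : α → ℝ} (hf : Measurable f) (hfi : Integrable f ν) {r : ℝ}
    (hr : 0 < r) :
    Tendsto (fun n : ℕ => (Measure.pi fun _ : Fin n => ν)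
      {y | n * r < |∑ i, f (y i) - n * ∫ x, f x ∂ν|}) atTop (𝓝 0) := by
  set P := Measure.infinitePi fun _ : ℕ => ν
  have hindep : iIndepFun (fun (i : ℕ) (ω : ℕ → α) => f (ω i)) P :=
    iIndepFun_infinitePi (X := fun _ => f) fun _ => hf
  have heval : ∀ i : ℕ, MeasurePreserving (fun ω : ℕ → α => ω i) P ν := fun i =>
    measurePreserving_eval_infinitePi _ i
  have hfe : ∀ i : ℕ, Measurable fun ω : ℕ → α => f (ω i) := fun i =>
    hf.comp (measurable_pi_apply i)
  have hident : ∀ i : ℕ, IdentDistrib (fun ω : ℕ → α => f (ω i)) (fun ω => f (ω 0)) P P :=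
    fun i => ⟨(hfe i).aemeasurable, (hfe 0).aemeasurable, by
      rw [← Function.comp_def f, ← Function.comp_def f, ← Measure.map_map hf (by fun_prop),
        ← Measure.map_map hf (by fun_prop), (heval i).map_eq, (heval 0).map_eq]⟩
  have hlln := strong_law_ae_real (fun (i : ℕ) (ω : ℕ → α) => f (ω i))
    ((heval 0).integrable_comp_of_integrable hfi) (fun _ _ hij => hindep.indepFun hij) hident
  have hmean : P[fun ω => f (ω 0)] = ∫ x, f x ∂ν := by
    rw [← (heval 0).map_eq, integral_map (by exact (measurable_pi_apply 0).aemeasurable)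
      hf.aestronglyMeasurable]
  have hmeasure := tendstoInMeasure_of_tendsto_ae (fun n =>
    ((Finset.measurable_fun_sum _ fun i _ => hfe i).div_const (n : ℝ)).aestronglyMeasurable) hlln
  rw [tendstoInMeasure_iff_dist] at hmeasure
  refine tendsto_of_tendsto_of_tendsto_of_le_of_le tendsto_const_nhds (hmeasure r hr)
    (fun _ => zero_le) fun n => ?_
  have hcoord : Measurable fun (ω : ℕ → α) (i : Fin n) => ω i := by fun_prop
  rw [← map_infinitePi_fin_eq_pi, Measure.map_apply hcoord]
  · refine measure_mono fun ω hω => ?_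
    change n * r < |∑ i : Fin n, f (ω i) - n * ∫ x, f x ∂ν| at hω
    rw [Fin.sum_univ_eq_sum_range fun i => f (ω i)] at hω
    rcases n.eq_zero_or_pos with rfl | hn
    · simp at hω
    have hn' : (0 : ℝ) < n := by exact_mod_cast hn
    change r ≤ dist _ _
    rw [hmean, Real.dist_eq, ← mul_le_mul_iff_right₀ hn', ← abs_of_pos hn', ← abs_mul,
      abs_of_pos hn', mul_sub, mul_div_cancel₀ _ hn'.ne']
    exact hω.le
  · exact measurableSet_lt measurable_const (by fun_prop)

end LawOfLargeNumbers

section Subexponential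

theorem exists_ofReal_exp_neg_le {m : ℝ≥0∞} (hm : 0 < m) :
    ∃ A > 0, ENNReal.ofReal (Real.exp (-A)) ≤ m := by
  have htendsto : Tendsto (fun A => ENNReal.ofReal (Real.exp (-A))) atTop (𝓝 0) := by
    simpa using ENNReal.tendsto_ofReal Real.tendsto_exp_neg_atTop_nhds_zero
  obtain ⟨A, hAm, hA⟩ := ((htendsto.eventually_lt_const hm).and (eventually_gt_atTop 0)).exists
  exact ⟨A, hA, hAm.le⟩

theorem exists_exp_neg_le_lconvPow {h : ℝ → ℝ≥0∞} (hh : Measurable h)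
    (hlow : 0 < ∫⁻ s in Set.Iio 1, h s) (hhigh : 0 < ∫⁻ s in Set.Ioi 1, h s) :
    ∃ m : ℕ, ∃ A > 0, ∀ (j : ℕ) (w : ℝ), |w - (j + 1) * (m + 1)| ≤ 1 + j * (1 / 2) →
      ENNReal.ofReal (Real.exp (-(A * (j + 1)))) ≤ lconvPow h ((m + 1) * j + m) w := by
  obtain ⟨m, δ, hδ, hnear⟩ := exists_le_lconvPow_near_mean hh hlow hhigh
  have hκ : 0 < δ * ENNReal.ofReal (1 / 2) := ENNReal.mul_pos hδ.ne' (by simp)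
  obtain ⟨A, hA, hexp⟩ := exists_ofReal_exp_neg_le (lt_min hδ hκ)
  refine ⟨m, A, hA, fun j w hw => ?_⟩
  have hsplit : Real.exp (-(A * (j + 1))) = Real.exp (-A) * Real.exp (-A) ^ j := by
    rw [← Real.exp_nat_mul, ← Real.exp_add]
    ring_nf
  rw [hsplit, ENNReal.ofReal_mul (Real.exp_pos _).le, ENNReal.ofReal_pow (Real.exp_pos _).le,
    ← lconvPow_lconvPow hh]
  exact (mul_le_mul' (hexp.trans (min_le_left _ _))
    (pow_le_pow_left' (hexp.trans (min_le_right _ _)) j)).trans (le_lconvPow one_pos hnear j hw)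

variable {g : ℝ → ℝ}

theorem eventually_half_le_pi_abs_sqSum_sub_le (hg : Measurable g) (hg0 : ∀ x, 0 ≤ g x)
    [IsProbabilityMeasure (densityMeasure g)] (h2 : ∫ x, g x * x ^ 2 = 1) {r : ℝ} (hr : 0 < r) :
    ∀ᶠ n : ℕ in atTop, 2⁻¹ ≤ (Measure.pi fun _ : Fin n => densityMeasure g)
      {y | |sqSum y - n| ≤ n * r} := by
  have hlln := tendsto_pi_lt_abs_sum_sub_mul_integral (densityMeasure g) (f := fun v => v ^ 2)
    (by fun_prop) (integrable_sq_densityMeasure hg hg0 h2) hr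
  filter_upwards [hlln.eventually_lt_const (u := 2⁻¹) (by simp)] with n hn
  rw [integral_densityMeasure hg hg0, h2] at hn
  have hmeas : MeasurableSet {y : Fin n → ℝ | |sqSum y - n| ≤ n * r} :=
    measurableSet_le (by fun_prop) measurable_const
  rw [← compl_compl {y : Fin n → ℝ | _}, prob_compl_eq_one_sub hmeas.compl,
    ← ENNReal.one_sub_inv_two]
  refine tsub_le_tsub_left ((measure_mono fun y hy => ?_).trans hn.le) 1
  simpa [sqSum] using hy

theorem mul_pi_abs_sqSum_sub_le_le_lconvPow (hg : Measurable g) {j : ℕ} {a ρ : ℝ} {δ : ℝ≥0∞}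
    (hδ : ∀ w, |w - a| ≤ ρ → δ ≤ lconvPow (sqDensity g) j w) (M : ℕ) :
    δ * (Measure.pi fun _ : Fin M => densityMeasure g) {y | |sqSum y - M| ≤ ρ} ≤
      lconvPow (sqDensity g) (M + j) (a + M) := by
  rw [← setLIntegral_const, ← lintegral_lconvPow_sub_sqSum hg]
  refine (setLIntegral_mono' (measurableSet_le (by fun_prop) measurable_const)
    fun y (hy : _ ≤ _) => hδ _ ?_).trans (setLIntegral_le_lintegral _ _)
  rwa [show a + M - sqSum y - a = -(sqSum y - M) by ring, abs_neg]

theorem exists_eq_add_blocks {m D n : ℕ} (hD : 2 * (m + 1) ≤ D) (hn : D ≤ n) :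
    ∃ j M, n = M + ((m + 1) * j + m) ∧ (j + 1) * D ≤ n ∧ n < (j + 2) * D ∧ n ≤ 2 * M := by
  obtain ⟨j, hj⟩ := Nat.exists_eq_succ_of_ne_zero (Nat.div_pos hn (by lia)).ne'
  have hjD : (j + 1) * D ≤ n := Nat.succ_eq_add_one j ▸ hj ▸ Nat.div_mul_le_self n D
  obtain ⟨M, hM⟩ := Nat.exists_eq_add_of_le' (by nlinarith : (m + 1) * j + m ≤ n)
  exact ⟨j, M, hM, hjD, (Nat.div_lt_iff_lt_mul (by lia)).1 (by lia), by nlinarith⟩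

theorem ofReal_exp_neg_le_mul_inv_two {a b : ℝ} (hab : a + 1 ≤ b) :
    ENNReal.ofReal (Real.exp (-b)) ≤ ENNReal.ofReal (Real.exp (-a)) * 2⁻¹ := by
  have hexp_one : Real.exp (-1) ≤ 2⁻¹ := by
    rw [Real.exp_neg]
    exact inv_anti₀ two_pos (by linarith [Real.add_one_le_exp 1])
  rw [← ENNReal.ofReal_ofNat 2, ← ENNReal.ofReal_inv_of_pos two_pos,
    ← ENNReal.ofReal_mul (Real.exp_pos _).le]
  refine ENNReal.ofReal_le_ofReal ?_
  calc Real.exp (-b) ≤ Real.exp (-a + -1) := Real.exp_le_exp.2 (by linarith)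
    _ ≤ Real.exp (-a) * 2⁻¹ := by rw [Real.exp_add]; gcongr

theorem eventually_exp_neg_le_lconvPow_sqDensity (hg : Measurable g) (hg0 : ∀ x, 0 ≤ g x)
    [IsProbabilityMeasure (densityMeasure g)] (h2 : ∫ x, g x * x ^ 2 = 1) {ε : ℝ} (hε : 0 < ε) :
    ∀ᶠ n : ℕ in atTop,
      ENNReal.ofReal (Real.exp (-(ε * n))) ≤ lconvPow (sqDensity g) n (n + 1) := by
  obtain ⟨m, A, hA, hblocks⟩ := exists_exp_neg_le_lconvPow (measurable_sqDensity hg)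
    (setLIntegral_Iio_sqDensity_pos hg hg0 h2) (setLIntegral_Ioi_sqDensity_pos hg hg0 h2)
  -- `n / D` blocks of `m + 1` particles absorb the fluctuation `M / (2 * D)` of the energy of the
  -- other `M` particles; each block costs a factor `exp (-A)`, so `D` is chosen large.
  obtain ⟨D, hD⟩ := exists_nat_ge (max (2 * (m + 1) : ℝ) (2 * A / ε))
  have hDm : 2 * (m + 1) ≤ D := by exact_mod_cast (le_max_left _ _).trans hD
  have hDA : 2 * A ≤ D * ε := (div_le_iff₀ hε).1 ((le_max_right _ _).trans hD)
  have hD0 : (0 : ℝ) < D := by exact_mod_cast (by lia : 0 < D)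
  obtain ⟨M₀, hM₀⟩ := eventually_atTop.1 (eventually_half_le_pi_abs_sqSum_sub_le hg hg0 h2
    (r := 1 / (2 * D)) (by positivity))
  filter_upwards [eventually_ge_atTop D, eventually_ge_atTop (2 * M₀),
    eventually_ge_atTop ⌈2 / ε⌉₊] with n hnD hnM₀ hnε
  obtain ⟨j, M, hM, hjD, hjD', hMn'⟩ := exists_eq_add_blocks hDm hnD
  have hM' : (n : ℝ) + 1 = (j + 1) * (m + 1) + M := by rw [hM]; push_cast; ring
  have hMn : (M : ℝ) ≤ n := by exact_mod_cast hM ▸ Nat.le_add_right _ _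
  have hfluct : M * (1 / (2 * D)) ≤ 1 + j * (1 / 2 : ℝ) := by
    have : (n : ℝ) < (j + 2) * D := by exact_mod_cast hjD'
    rw [mul_one_div, div_le_iff₀ (by positivity)]
    linarith
  have hcost : A * (j + 1) + 1 ≤ ε * n := by
    have hn : 2 ≤ n * ε := (div_le_iff₀ hε).1 (Nat.ceil_le.1 hnε)
    have : ((j : ℝ) + 1) * D ≤ n := by exact_mod_cast hjD
    nlinarith [hA]
  calc ENNReal.ofReal (Real.exp (-(ε * n)))
      ≤ ENNReal.ofReal (Real.exp (-(A * (j + 1)))) * 2⁻¹ := ofReal_exp_neg_le_mul_inv_two hcost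
    _ ≤ lconvPow (sqDensity g) (M + ((m + 1) * j + m)) ((j + 1) * (m + 1) + M) := by
        refine le_trans ?_ (mul_pi_abs_sqSum_sub_le_le_lconvPow hg
          (fun w hw => hblocks j w (hw.trans hfluct)) M)
        gcongr
        exact hM₀ M (by lia)
    _ = lconvPow (sqDensity g) n (n + 1) := by rw [← hM, ← hM']

end Subexponential

section Boundedness

theorem exists_forall_lintegral_enorm_rpow_lt_top {α E : Type*} [MeasurableSpace α]
    {μ : Measure α} [NormedAddCommGroup E] {f : α → E} (h1 : MemLp f 1 μ) {p : ℝ≥0∞} (hp : 1 < p)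
    (hfp : MemLp f p μ) :
    ∃ p' > (1 : ℝ), ∀ r ∈ Set.Icc 1 p', ∫⁻ x, ‖f x‖ₑ ^ r ∂μ < ∞ := by
  have h1' : ∫⁻ x, ‖f x‖ₑ ∂μ < ∞ := by simpa [eLpNorm_one_eq_lintegral_enorm] using h1.2
  rcases eq_or_ne p ∞ with rfl | htop
  · refine ⟨2, one_lt_two, fun r hr => ?_⟩
    have hB : eLpNormEssSup f μ < ∞ := by simpa using hfp.2
    calc ∫⁻ x, ‖f x‖ₑ ^ r ∂μ ≤ ∫⁻ x, eLpNormEssSup f μ ^ (r - 1) * ‖f x‖ₑ ∂μ := by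
          refine lintegral_mono_ae ?_
          filter_upwards [enorm_ae_le_eLpNormEssSup f μ] with x hx
          calc ‖f x‖ₑ ^ r = ‖f x‖ₑ ^ (r - 1) * ‖f x‖ₑ ^ (1 : ℝ) := by
                rw [← ENNReal.rpow_add_of_nonneg _ _ (sub_nonneg.2 hr.1) zero_le_one,
                  sub_add_cancel]
            _ ≤ eLpNormEssSup f μ ^ (r - 1) * ‖f x‖ₑ := by
                rw [ENNReal.rpow_one]
                gcongr
                exact sub_nonneg.2 hr.1
      _ = eLpNormEssSup f μ ^ (r - 1) * ∫⁻ x, ‖f x‖ₑ ∂μ :=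
          lintegral_const_mul' _ _ (ENNReal.rpow_ne_top_of_nonneg (sub_nonneg.2 hr.1) hB.ne)
      _ < ∞ := ENNReal.mul_lt_top (ENNReal.rpow_lt_top_of_nonneg (sub_nonneg.2 hr.1) hB.ne) h1'
  · have hp_int := lintegral_rpow_enorm_lt_top_of_eLpNorm_lt_top (zero_lt_one.trans hp).ne' htop
      hfp.2
    refine ⟨p.toReal, by simpa using (ENNReal.toReal_lt_toReal (by simp) htop).2 hp,
      fun r hr => ?_⟩
    calc ∫⁻ x, ‖f x‖ₑ ^ r ∂μ ≤ ∫⁻ x, (‖f x‖ₑ + ‖f x‖ₑ ^ p.toReal) ∂μ := by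
          refine lintegral_mono fun x => ?_
          rcases le_total ‖f x‖ₑ 1 with h | h
          · exact (ENNReal.rpow_le_self_of_le_one h hr.1).trans le_self_add
          · exact (ENNReal.rpow_le_rpow_of_exponent_le h hr.2).trans le_add_self
      _ = ∫⁻ x, ‖f x‖ₑ ∂μ + ∫⁻ x, ‖f x‖ₑ ^ p.toReal ∂μ :=
          lintegral_add_left' h1.1.enorm _
      _ < ∞ := ENNReal.add_lt_top.2 ⟨h1', hp_int⟩

theorem rpow_mul_rpow_le_add (x y : ℝ≥0∞) {a b : ℝ} (ha : 0 ≤ a) (hb : 0 ≤ b) :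
    x ^ a * y ^ b ≤ x ^ (a + b) + y ^ (a + b) := by
  rcases le_total x y with h | h
  · calc x ^ a * y ^ b ≤ y ^ a * y ^ b := by gcongr
      _ = y ^ (a + b) := (ENNReal.rpow_add_of_nonneg _ _ ha hb).symm
      _ ≤ _ := le_add_self
  · calc x ^ a * y ^ b ≤ x ^ a * x ^ b := by gcongr
      _ = x ^ (a + b) := (ENNReal.rpow_add_of_nonneg _ _ ha hb).symm
      _ ≤ _ := le_self_add

theorem setLIntegral_ball_inv_abs_rpow_lt_top {α : ℝ} (hα : α < 1) :
    ∫⁻ v in Metric.ball (0 : ℝ) 1, (ENNReal.ofReal |v|)⁻¹ ^ α < ∞ := by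
  have hint : IntegrableOn (fun v : ℝ => |v| ^ (-α)) (Metric.ball 0 1) :=
    integrableOn_ball_of_norm_le_rpow (C := 1) (α := α) (by simp) (by simpa using hα)
      (ae_of_all _ fun v => by simp [abs_of_nonneg (Real.rpow_nonneg (abs_nonneg v) _)])
      (measurable_norm.pow_const _).aestronglyMeasurable
  refine (lintegral_mono_ae ?_).trans_lt hint.2
  filter_upwards [ae_restrict_of_ae (Measure.ae_ne volume 0)] with v hv
  rw [← ENNReal.rpow_neg_one, ← ENNReal.rpow_mul, neg_one_mul,
    ENNReal.ofReal_rpow_of_pos (abs_pos.2 hv),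
    Real.enorm_of_nonneg (Real.rpow_nonneg (abs_nonneg v) _)]

variable {g : ℝ → ℝ}

theorem sqDensity_sq_le (hg0 : ∀ x, 0 ≤ g x) (v : ℝ) :
    sqDensity g (v ^ 2) ≤ ‖g v + g (-v)‖ₑ * (ENNReal.ofReal |v|)⁻¹ := by
  have hsum : ENNReal.ofReal (g |v|) + ENNReal.ofReal (g (-|v|)) = ‖g v + g (-v)‖ₑ := by
    rw [Real.enorm_of_nonneg (add_nonneg (hg0 _) (hg0 _)), ENNReal.ofReal_add (hg0 _) (hg0 _)]
    rcases abs_choice v with h | h <;> rw [h]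
    rw [neg_neg, add_comm]
  rw [sqDensity]
  split_ifs
  · rw [Real.sqrt_sq_eq_abs, hsum, ← div_eq_mul_inv]
    exact mul_le_of_le_one_left' (by simp)
  · exact bot_le

theorem ofReal_mul_sqDensity_rpow_le (hg0 : ∀ x, 0 ≤ g x) {θ : ℝ} (hθ : 0 ≤ θ) (v : ℝ) :
    ENNReal.ofReal (g v) * sqDensity g (v ^ 2) ^ θ ≤
      ‖g v + g (-v)‖ₑ ^ (1 + θ) + (‖g v + g (-v)‖ₑ ^ (1 + 3 * θ) +
        (Metric.ball 0 1).indicator (fun v => (ENNReal.ofReal |v|)⁻¹ ^ ((1 + 3 * θ) / 2)) v) := by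
  have hg_le : ENNReal.ofReal (g v) ≤ ‖g v + g (-v)‖ₑ := by
    rw [Real.enorm_of_nonneg (add_nonneg (hg0 _) (hg0 _))]
    exact ENNReal.ofReal_le_ofReal (le_add_of_nonneg_right (hg0 _))
  have hle : ENNReal.ofReal (g v) * sqDensity g (v ^ 2) ^ θ ≤
      ‖g v + g (-v)‖ₑ ^ (1 + θ) * (ENNReal.ofReal |v|)⁻¹ ^ θ := by
    rw [ENNReal.rpow_add_of_nonneg _ _ zero_le_one hθ, ENNReal.rpow_one, mul_assoc,
      ← ENNReal.mul_rpow_of_nonneg _ _ hθ]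
    gcongr
    exact sqDensity_sq_le hg0 v
  refine hle.trans ?_
  by_cases hv : v ∈ Metric.ball (0 : ℝ) 1
  · have h := rpow_mul_rpow_le_add ‖g v + g (-v)‖ₑ ((ENNReal.ofReal |v|)⁻¹ ^ (1 / 2 : ℝ))
      (a := 1 + θ) (b := 2 * θ) (by positivity) (by positivity)
    rw [← ENNReal.rpow_mul, ← ENNReal.rpow_mul, show 1 / 2 * (2 * θ) = θ by ring,
      show 1 + θ + 2 * θ = 1 + 3 * θ by ring, one_div_mul_eq_div] at h
    rw [Set.indicator_of_mem hv]
    exact h.trans le_add_self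
  · have hv1 : 1 ≤ |v| := by simpa using hv
    have hinv : (ENNReal.ofReal |v|)⁻¹ ^ θ ≤ 1 := ENNReal.rpow_le_one (by simpa using hv1) hθ
    exact (mul_le_of_le_one_right' hinv).trans le_self_add

theorem lintegral_sqDensity_rpow_lt_top (hg : Measurable g) (hg0 : ∀ x, 0 ≤ g x) {θ : ℝ}
    (hθ : 0 ≤ θ) (hθ' : 3 * θ < 1) (h₁ : ∫⁻ v, ‖g v + g (-v)‖ₑ ^ (1 + θ) < ∞)
    (h₃ : ∫⁻ v, ‖g v + g (-v)‖ₑ ^ (1 + 3 * θ) < ∞) : ∫⁻ s, sqDensity g s ^ (1 + θ) < ∞ := by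
  have hh := measurable_sqDensity hg
  calc ∫⁻ s, sqDensity g s ^ (1 + θ) = ∫⁻ s, sqDensity g s * sqDensity g s ^ θ := by
        simp only [ENNReal.rpow_add_of_nonneg _ _ zero_le_one hθ, ENNReal.rpow_one]
    _ = ∫⁻ v, ENNReal.ofReal (g v) * sqDensity g (v ^ 2) ^ θ := by
        rw [lintegral_sqDensity_mul hg (by fun_prop), densityMeasure,
          lintegral_withDensity_eq_lintegral_mul _ (by fun_prop) (by fun_prop)]
        rfl
    _ ≤ _ := lintegral_mono (ofReal_mul_sqDensity_rpow_le hg0 hθ)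
    _ = (∫⁻ v, ‖g v + g (-v)‖ₑ ^ (1 + θ)) + ((∫⁻ v, ‖g v + g (-v)‖ₑ ^ (1 + 3 * θ)) +
          ∫⁻ v in Metric.ball 0 1, (ENNReal.ofReal |v|)⁻¹ ^ ((1 + 3 * θ) / 2)) := by
        rw [lintegral_add_left (by fun_prop), lintegral_add_left (by fun_prop),
          lintegral_indicator Metric.isOpen_ball.measurableSet]
    _ < ∞ := ENNReal.add_lt_top.2 ⟨h₁, ENNReal.add_lt_top.2
        ⟨h₃, setLIntegral_ball_inv_abs_rpow_lt_top (by linarith)⟩⟩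

theorem exists_lintegral_sqDensity_rpow_lt_top (hg : Measurable g) (hg0 : ∀ x, 0 ≤ g x)
    (hint : Integrable g) {p : ℝ≥0∞} (hp : 1 < p) (hgp : MemLp g p) :
    ∃ n : ℕ, n ≠ 0 ∧ ∫⁻ s, sqDensity g s ^ (1 + 1 / n : ℝ) < ∞ := by
  have hsymm {q : ℝ≥0∞} (hq : MemLp g q volume) : MemLp (fun v => g v + g (-v)) q volume :=
    hq.add (hq.comp_measurePreserving (Measure.measurePreserving_neg volume))
  obtain ⟨p', hp', hfin⟩ := exists_forall_lintegral_enorm_rpow_lt_top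
    (hsymm (memLp_one_iff_integrable.2 hint)) hp (hsymm hgp)
  obtain ⟨n, hn⟩ := exists_nat_gt (max 3 (3 / (p' - 1)))
  have hn3 : (3 : ℝ) < n := (le_max_left _ _).trans_lt hn
  have hn0 : (0 : ℝ) < n := by linarith
  have hp3 : 1 + 3 * (1 / n : ℝ) ≤ p' := by
    have h := (div_lt_iff₀ (sub_pos.2 hp')).1 ((le_max_right _ _).trans_lt hn)
    rw [mul_one_div, ← le_sub_iff_add_le', div_le_iff₀' hn0]
    exact h.le
  have hθ : (0 : ℝ) ≤ 1 / n := by positivity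
  refine ⟨n, Nat.cast_ne_zero.1 hn0.ne', lintegral_sqDensity_rpow_lt_top hg hg0 hθ ?_
    (hfin _ ⟨by linarith, by linarith⟩) (hfin _ ⟨by linarith, hp3⟩)⟩
  rwa [mul_one_div, div_lt_one hn0]

variable {h : ℝ → ℝ≥0∞}

theorem lconvPow_eq_lintegral_pi (hh : Measurable h) (n : ℕ) (w : ℝ) :
    lconvPow h n w = ∫⁻ s : Fin n → ℝ, h (w - ∑ i, s i) * ∏ i, h (s i) := by
  induction n generalizing w with
  | zero => simp [lconvPow, volume_pi]
  | succ n ih =>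
    have hF : Measurable fun s : Fin (n + 1) → ℝ => h (w - ∑ i, s i) * ∏ i, h (s i) := by fun_prop
    rw [volume_pi, lintegral_pi_cons volume hF, lintegral_lintegral_swap (by fun_prop), lconvPow,
      lconvolution_def]
    refine lintegral_congr fun t => ?_
    rw [ih, ← lintegral_const_mul _ (by fun_prop), volume_pi]
    refine lintegral_congr fun s => ?_
    simp only [Fin.sum_univ_succ, Fin.prod_univ_succ, Fin.cons_zero, Fin.cons_succ]
    rw [sub_add_eq_sub_sub, sub_eq_neg_add w t]
    ring

/-- The proof factors out the power of the smallest of the `a i`. -/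
theorem prod_le_sum_prod_succAbove_rpow {n : ℕ} (hn : n ≠ 0) (a : Fin (n + 1) → ℝ≥0∞) :
    ∏ i, a i ≤ ∑ i : Fin (n + 1), ∏ j, a (i.succAbove j) ^ (1 + 1 / n : ℝ) := by
  obtain ⟨i, -, hmin⟩ := Finset.univ.exists_min_image a Finset.univ_nonempty
  set R := ∏ j, a (i.succAbove j)
  have hn0 : (0 : ℝ) < n := by positivity
  have hpow : a i ^ n ≤ R := by
    simpa using Finset.prod_le_prod' (s := Finset.univ) fun (j : Fin n) _ =>
      hmin (i.succAbove j) (Finset.mem_univ _)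
  have hle : a i ≤ R ^ (1 / n : ℝ) := by
    rwa [one_div, ENNReal.le_rpow_inv_iff hn0, ENNReal.rpow_natCast]
  calc ∏ i, a i = a i * R := Fin.prod_univ_succAbove a i
    _ ≤ R ^ (1 / n : ℝ) * R ^ (1 : ℝ) := by
        rw [ENNReal.rpow_one]
        gcongr
    _ = ∏ j, a (i.succAbove j) ^ (1 + 1 / n : ℝ) := by
        rw [← ENNReal.rpow_add_of_nonneg _ _ (by positivity) zero_le_one, add_comm,
          ENNReal.prod_rpow_of_nonneg (by positivity)]
    _ ≤ _ := Finset.single_le_sum (f := fun i => ∏ j, a (Fin.succAbove i j) ^ (1 + 1 / n : ℝ))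
        (fun _ _ => bot_le) (Finset.mem_univ i)

theorem lintegral_prod_cons_sub_sum_succAbove (hh : Measurable h) (w : ℝ) {n : ℕ}
    (i : Fin (n + 1)) :
    ∫⁻ s : Fin n → ℝ, ∏ j, h (Fin.cons (α := fun _ => ℝ) (w - ∑ l, s l) s (i.succAbove j)) =
      (∫⁻ t, h t) ^ n := by
  cases i using Fin.cases with
  | zero =>
    simp only [Fin.succAbove_zero, Fin.cons_succ]
    rw [volume_pi, lintegral_prod_pi volume fun _ => hh]
    simp
  | succ i =>
    obtain _ | n := n
    · exact i.elim0
    rw [← (volume_preserving_piFinSuccAbove (fun _ => ℝ) i).symm.lintegral_comp_emb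
      (MeasurableEquiv.measurableEmbedding _)]
    simp only [Fin.prod_univ_succ, Fin.succ_succAbove_zero, Fin.succ_succAbove_succ, Fin.cons_zero,
      Fin.cons_succ, MeasurableEquiv.piFinSuccAbove_symm_apply, Fin.sum_univ_succAbove _ i,
      Fin.insertNthEquiv_apply, Fin.insertNth_apply_same, Fin.insertNth_apply_succAbove]
    rw [Measure.volume_eq_prod, lintegral_prod_symm' _ (by fun_prop)]
    calc ∫⁻ y : Fin n → ℝ, ∫⁻ t, h (w - (t + ∑ j, y j)) * ∏ j, h (y j)
        = ∫⁻ y : Fin n → ℝ, (∫⁻ t, h t) * ∏ j, h (y j) := by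
          refine lintegral_congr fun y => ?_
          simp only [add_comm _ (∑ j, y j), ← sub_sub]
          rw [lintegral_mul_const _ (by fun_prop), lintegral_sub_left_eq_self]
      _ = (∫⁻ t, h t) ^ (n + 1) := by
          rw [lintegral_const_mul _ (by fun_prop), volume_pi, lintegral_prod_pi volume fun _ => hh,
            pow_succ']
          simp

theorem lconvPow_le (hh : Measurable h) {n : ℕ} (hn : n ≠ 0) (w : ℝ) :
    lconvPow h n w ≤ (n + 1) * (∫⁻ s, h s ^ (1 + 1 / n : ℝ)) ^ n := by
  calc lconvPow h n w
      = ∫⁻ s : Fin n → ℝ, ∏ i, h (Fin.cons (α := fun _ => ℝ) (w - ∑ l, s l) s i) := by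
        simp only [lconvPow_eq_lintegral_pi hh, Fin.prod_univ_succ, Fin.cons_zero, Fin.cons_succ]
    _ ≤ ∫⁻ s : Fin n → ℝ, ∑ i : Fin (n + 1), ∏ j,
          h (Fin.cons (α := fun _ => ℝ) (w - ∑ l, s l) s (i.succAbove j)) ^ (1 + 1 / n : ℝ) :=
        lintegral_mono fun s => prod_le_sum_prod_succAbove_rpow hn _
    _ = ∑ _ : Fin (n + 1), (∫⁻ s, h s ^ (1 + 1 / n : ℝ)) ^ n := by
        rw [lintegral_finsetSum _ ?_]
        · exact Finset.sum_congr rfl fun i _ =>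
            lintegral_prod_cons_sub_sum_succAbove (hh.pow_const _) w i
        · exact fun i _ => Fin.cases (by fun_prop) (fun _ => by fun_prop) i
    _ = (n + 1) * (∫⁻ s, h s ^ (1 + 1 / n : ℝ)) ^ n := by simp

theorem exists_lconvPow_sqDensity_le (hg : Measurable g) (hg0 : ∀ x, 0 ≤ g x)
    (hint : Integrable g) {p : ℝ≥0∞} (hp : 1 < p) (hgp : MemLp g p) :
    ∃ m : ℕ, ∃ K : ℝ≥0∞, K ≠ ∞ ∧ ∀ w, lconvPow (sqDensity g) m w ≤ K := by
  obtain ⟨n, hn, hfin⟩ := exists_lintegral_sqDensity_rpow_lt_top hg hg0 hint hp hgp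
  refine ⟨n, _, ?_, lconvPow_le (measurable_sqDensity hg) hn⟩
  exact ENNReal.mul_ne_top (by simp) (ENNReal.pow_ne_top hfin.ne)

end Boundedness

section Domination

variable {g : ℝ → ℝ}

theorem lintegral_lconvPow_sub_sqSum_mul (hg : Measurable g) {r : ℕ} {W : (Fin r → ℝ) → ℝ≥0∞}
    (hW : Measurable W) (m j : ℕ) (w : ℝ) :
    ∫⁻ y : Fin (r + m) → ℝ, lconvPow (sqDensity g) j (w - sqSum y) * W (fun i => y (i.addNat m))
        ∂(Measure.pi fun _ => densityMeasure g) =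
      ∫⁻ y, lconvPow (sqDensity g) (m + j) (w - sqSum y) * W y
        ∂(Measure.pi fun _ => densityMeasure g) := by
  have hh := measurable_sqDensity hg
  induction m generalizing j with
  | zero => simp
  | succ m ih =>
    rw [Nat.add_right_comm, add_assoc m, ← ih]
    refine (lintegral_pi_cons (n := r + m) (densityMeasure g) (by fun_prop)).trans
      (lintegral_congr fun y => ?_)
    have htail (t : ℝ) : (fun i : Fin r => (Fin.cons t y : Fin (r + m + 1) → ℝ)
        (i.addNat (m + 1))) = fun i => y (i.addNat m) := rfl
    simp only [sqSum_cons, add_comm _ (sqSum y), ← sub_sub, htail]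
    rw [lintegral_mul_const _ (by fun_prop), lconvPow,
      ← lintegral_comp_sub_sq hg (measurable_lconvPow hh j)]

theorem lintegral_tensorDensity_mul_addNat_le (hg : Measurable g) {m : ℕ} {K : ℝ≥0∞}
    (hK : ∀ w, lconvPow (sqDensity g) m w ≤ K) {r : ℕ} {W : (Fin r → ℝ) → ℝ≥0∞}
    (hW : Measurable W) :
    ∫⁻ v, tensorDensity g (r + (m + 1)) v * W (fun i => v.1.ofLp (i.addNat (m + 1)))
        ∂(unif (r + (m + 1))) ≤
      2 * sliceConst (r + m) * (K * ∫⁻ y, W y ∂(Measure.pi fun _ => densityMeasure g)) := by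
  refine (lintegral_tensorDensity_mul_unif hg (n := r + m)
    (W := fun y => W fun i => y (i.addNat m)) (by fun_prop)).le.trans ?_
  rw [← lintegral_const_mul _ hW]
  gcongr
  refine (lintegral_lconvPow_sub_sqSum_mul hg hW m 0 _).le.trans (lintegral_mono fun y => ?_)
  gcongr
  exact hK _

end Domination

section ConditionedTensor

variable {g : ℝ → ℝ}

@[fun_prop]
theorem measurable_tensorDensity (hg : Measurable g) (N : ℕ) : Measurable (tensorDensity g N) := by
  unfold tensorDensity
  fun_prop

theorem isProbabilityMeasure_condTensor {N : ℕ} (h0 : Z g N ≠ 0) (ht : Z g N ≠ ∞) :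
    IsProbabilityMeasure (condTensor g N) := by
  refine ⟨?_⟩
  rw [condTensor, Measure.smul_apply, withDensity_apply _ MeasurableSet.univ, setLIntegral_univ,
    smul_eq_mul, ← Z, ENNReal.inv_mul_cancel h0 ht]

theorem lintegral_condTensor (hg : Measurable g) (N : ℕ) {F : KacSphere N → ℝ≥0∞}
    (hF : Measurable F) :
    ∫⁻ v, F v ∂(condTensor g N) = (Z g N)⁻¹ * ∫⁻ v, tensorDensity g N v * F v ∂(unif N) := by
  rw [condTensor, lintegral_smul_measure,
    lintegral_withDensity_eq_lintegral_mul _ (measurable_tensorDensity hg N) hF]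
  rfl

theorem eventually_Z_pos (hg : Measurable g) (hg0 : ∀ x, 0 ≤ g x)
    [IsProbabilityMeasure (densityMeasure g)] (h2 : ∫ x, g x * x ^ 2 = 1) :
    ∀ᶠ N : ℕ in atTop, 0 < Z g N := by
  rw [← map_add_atTop_eq_nat 1, eventually_map]
  filter_upwards [eventually_exp_neg_le_lconvPow_sqDensity hg hg0 h2 one_pos] with n hn
  rw [Z_eq_lconvPow_sqDensity hg]
  exact ENNReal.mul_pos (mul_ne_zero two_ne_zero (sliceConst_ne_zero n))
    ((ENNReal.ofReal_pos.2 (Real.exp_pos _)).trans_le hn).ne'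

theorem Z_lt_top (hg : Measurable g) [IsProbabilityMeasure (densityMeasure g)] {m : ℕ}
    {K : ℝ≥0∞} (hK : K ≠ ∞) (hle : ∀ w, lconvPow (sqDensity g) m w ≤ K) (r : ℕ) :
    Z g (r + (m + 1)) < ∞ := by
  have h := lintegral_tensorDensity_mul_addNat_le hg hle (r := r) (W := 1) measurable_const
  simp only [Pi.one_apply, mul_one, lintegral_const, measure_univ] at h
  exact h.trans_lt (ENNReal.mul_lt_top (ENNReal.mul_lt_top ENNReal.ofNat_lt_top
    (sliceConst_ne_top _).lt_top) hK.lt_top)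

theorem eventually_le_ofReal_exp {K : ℝ≥0∞} (hK : K ≠ ∞) (d : ℕ) {ε : ℝ} (hε : 0 < ε) :
    ∀ᶠ r : ℕ in atTop, K ≤ ENNReal.ofReal (Real.exp (ε * (r + d : ℕ))) := by
  have h : Tendsto (fun r : ℕ => ENNReal.ofReal (Real.exp (ε * (r + d : ℕ)))) atTop (𝓝 ∞) :=
    ENNReal.tendsto_ofReal_atTop.comp <| Real.tendsto_exp_atTop.comp <|
      (tendsto_natCast_atTop_atTop.comp (tendsto_add_atTop_nat d)).const_mul_atTop hε
  exact (h.eventually (lt_mem_nhds hK.lt_top)).mono fun _ => le_of_lt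

theorem eventually_map_condTensor_le (hg : Measurable g) (hg0 : ∀ x, 0 ≤ g x)
    [IsProbabilityMeasure (densityMeasure g)] (h2 : ∫ x, g x * x ^ 2 = 1) {m : ℕ} {K : ℝ≥0∞}
    (hK : K ≠ ∞) (hle : ∀ w, lconvPow (sqDensity g) m w ≤ K) {ε : ℝ} (hε : 0 < ε) :
    ∀ᶠ r : ℕ in atTop,
      (condTensor g (r + (m + 1))).map (fun v (i : Fin r) => v.1.ofLp (i.addNat (m + 1))) ≤
        ENNReal.ofReal (Real.exp (ε * (r + (m + 1) : ℕ))) •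
          Measure.pi fun _ => densityMeasure g := by
  filter_upwards [eventually_le_ofReal_exp hK (m + 1) (half_pos hε),
    (tendsto_add_atTop_nat m).eventually
      (eventually_exp_neg_le_lconvPow_sqDensity hg hg0 h2 (half_pos hε))] with r hKr hlow
  set L := lconvPow (sqDensity g) (r + m) ((r + m : ℕ) + 1)
  have hKL : K ≤ ENNReal.ofReal (Real.exp (ε * (r + (m + 1) : ℕ))) * L := by
    calc K ≤ ENNReal.ofReal (Real.exp (ε / 2 * (r + (m + 1) : ℕ))) := hKr
      _ ≤ ENNReal.ofReal (Real.exp (ε * (r + (m + 1) : ℕ))) *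
          ENNReal.ofReal (Real.exp (-(ε / 2 * (r + m : ℕ)))) := by
        rw [← ENNReal.ofReal_mul (Real.exp_pos _).le, ← Real.exp_add]
        gcongr
        push_cast
        nlinarith
      _ ≤ _ := by gcongr
  refine Measure.le_iff.2 fun s hs => ?_
  set W : (Fin r → ℝ) → ℝ≥0∞ := s.indicator 1
  have hW : Measurable W := measurable_one.indicator hs
  rw [Measure.smul_apply, smul_eq_mul, ← lintegral_indicator_one hs, ← lintegral_indicator_one hs,
    lintegral_map hW (by fun_prop), lintegral_condTensor hg _ (by fun_prop),
    ← ENNReal.div_eq_inv_mul]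
  set I := ∫⁻ y, W y ∂(Measure.pi fun _ => densityMeasure g)
  refine ENNReal.div_le_of_le_mul ?_
  calc _ ≤ 2 * sliceConst (r + m) * (K * I) := lintegral_tensorDensity_mul_addNat_le hg hle hW
    _ ≤ 2 * sliceConst (r + m) *
        (ENNReal.ofReal (Real.exp (ε * (r + (m + 1) : ℕ))) * L * I) := by gcongr
    _ = _ := by
        rw [show r + (m + 1) = r + m + 1 from rfl, Z_eq_lconvPow_sqDensity hg]
        ring

end ConditionedTensor

section Blocks

variable {α ι κ τ : Type*} [MeasurableSpace α] [Fintype ι] [Fintype κ] [Fintype τ]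

theorem map_pi_blocks (ν : Measure α) [IsProbabilityMeasure ν] (e : ι × κ ↪ τ) :
    (Measure.pi fun _ : τ => ν).map (fun y l i => y (e (l, i))) =
      Measure.pi fun _ : ι => Measure.pi fun _ : κ => ν := by
  have hproj := Measure.map_infinitePi_infinitePi_of_inj (P := fun _ : τ => ν) e.injective
  have hcurry := Measure.infinitePi_map_curry fun (_ : ι) (_ : κ) => ν
  simp only [← Measure.infinitePi_eq_pi]
  rw [← hcurry, ← hproj, Measure.map_map (MeasurableEquiv.measurable _) (by fun_prop)]
  rfl

theorem lintegral_prod_blocks (ν : Measure α) [IsProbabilityMeasure ν] (e : ι × κ ↪ τ)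
    {F : (κ → α) → ℝ≥0∞} (hF : Measurable F) :
    ∫⁻ y, ∏ l, F (fun i => y (e (l, i))) ∂(Measure.pi fun _ => ν) =
      (∫⁻ z, F z ∂(Measure.pi fun _ => ν)) ^ Fintype.card ι := by
  have hind : iIndepFun (fun (l : ι) (z : ι → κ → α) => F (z l))
      (Measure.pi fun _ => Measure.pi fun _ => ν) := iIndepFun_pi fun _ => hF.aemeasurable
  calc ∫⁻ y, ∏ l, F (fun i => y (e (l, i))) ∂(Measure.pi fun _ => ν)
      = ∫⁻ z : ι → κ → α, ∏ l, F (z l) ∂(Measure.pi fun _ => Measure.pi fun _ => ν) := by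
        rw [← map_pi_blocks ν e, lintegral_map (by fun_prop) (by fun_prop)]
    _ = ∏ l : ι, ∫⁻ z : ι → κ → α, F (z l) ∂(Measure.pi fun _ => Measure.pi fun _ => ν) :=
        lintegral_prod_eq_prod_lintegral_of_indepFun _ _ hind fun l => by fun_prop
    _ = (∫⁻ z, F z ∂(Measure.pi fun _ => ν)) ^ Fintype.card ι := by
        simp_rw [fun l => (measurePreserving_eval (fun _ : ι => Measure.pi fun _ : κ => ν)
          l).lintegral_comp hF]
        simp

end Blocks

section Symmetry

theorem exists_perm_comp_eq {α β : Type*} [Finite β] {a b : α → β} (ha : Function.Injective a)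
    (hb : Function.Injective b) : ∃ τ : Equiv.Perm β, ∀ i, τ (a i) = b i := by
  classical
  refine ⟨((Equiv.ofInjective a ha).symm.trans (Equiv.ofInjective b hb)).extendSubtype,
    fun i => ?_⟩
  rw [Equiv.extendSubtype_apply_of_mem _ _ (Set.mem_range_self i)]
  simp

@[fun_prop]
theorem measurable_permute {N : ℕ} (τ : Equiv.Perm (Fin N)) : Measurable (permute τ) :=
  Measurable.subtype_mk (by fun_prop)

theorem map_coords_eq_marginal {k N : ℕ} {m : ProbabilityMeasure (KacSphere N)}
    (hm : IsSymmetric m) {b : Fin k → Fin N} (hb : Function.Injective b) :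
    (m : Measure (KacSphere N)).map (fun v i => v.1.ofLp (b i)) = marginal k m := by
  have hk : k ≤ N := by simpa using Fintype.card_le_of_injective b hb
  obtain ⟨τ, hτ⟩ := exists_perm_comp_eq (Fin.castLE_injective hk) hb
  rw [marginal, ProbabilityMeasure.toMeasure_map]
  conv_rhs => rw [← hm τ, Measure.map_map (measurable_firstCoords k N) (measurable_permute τ)]
  congr 1
  ext v i
  rw [Function.comp_apply, firstCoords, dif_pos (i.2.trans_le hk), ← hτ i]
  rfl

end Symmetry

section BlockTest

variable {N k r M : ℕ} {b : Fin r → Fin N} {φ : (Fin k → ℝ) → ℝ} {C : ℝ}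

theorem integral_sum_blocks {m : ProbabilityMeasure (KacSphere N)} (hm : IsSymmetric m)
    (hb : Function.Injective b) (e : Fin M × Fin k ↪ Fin r) (hφ : Measurable φ)
    (hC : ∀ y, |φ y| ≤ C) :
    ∫ v, ∑ l, φ (fun i => v.1.ofLp (b (e (l, i)))) ∂(m : Measure (KacSphere N)) =
      M * ∫ y, φ y ∂(marginal k m : Measure (Fin k → ℝ)) := by
  rw [integral_finsetSum _ fun l _ => integrable_of_abs_le (by fun_prop) fun v => hC _]
  have hblock (l : Fin M) : ∫ v, φ (fun i => v.1.ofLp (b (e (l, i)))) ∂(m : Measure (KacSphere N)) =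
      ∫ y, φ y ∂(marginal k m : Measure (Fin k → ℝ)) := by
    have hinj : Function.Injective fun i => b (e (l, i)) :=
      hb.comp (e.injective.comp (Prod.mk_right_injective l))
    rw [← map_coords_eq_marginal hm hinj,
      integral_map (by fun_prop) hφ.aestronglyMeasurable]
  simp [hblock]

variable {P : Measure (KacSphere N)} {ν : Measure ℝ} [IsProbabilityMeasure ν] {c : ℝ}

theorem integral_exp_sum_blocks_le (e : Fin M × Fin k ↪ Fin r)
    (hP : P.map (fun v i => v.1.ofLp (b i)) ≤
      ENNReal.ofReal (Real.exp c) • Measure.pi fun _ => ν)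
    (hφ : Measurable φ) (hC : ∀ y, |φ y| ≤ C) :
    ∫ v, Real.exp (∑ l, φ (fun i => v.1.ofLp (b (e (l, i))))) ∂P ≤
      Real.exp c * (∫ y, Real.exp (φ y) ∂(Measure.pi fun _ => ν)) ^ M := by
  have hI : 0 ≤ ∫ y, Real.exp (φ y) ∂(Measure.pi fun _ => ν) :=
    integral_nonneg fun y => (Real.exp_pos _).le
  rw [integral_eq_lintegral_of_nonneg_ae (ae_of_all _ fun v => (Real.exp_pos _).le)
    (Measurable.aestronglyMeasurable (by fun_prop))]
  refine ENNReal.toReal_le_of_le_ofReal (by positivity) ?_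
  calc ∫⁻ v, ENNReal.ofReal (Real.exp (∑ l, φ (fun i => v.1.ofLp (b (e (l, i)))))) ∂P
      = ∫⁻ y, ∏ l, ENNReal.ofReal (Real.exp (φ fun i => y (e (l, i))))
          ∂(P.map fun v i => v.1.ofLp (b i)) := by
        rw [lintegral_map (by fun_prop) (by fun_prop)]
        simp only [Real.exp_sum, ENNReal.ofReal_prod_of_nonneg fun _ _ => (Real.exp_pos _).le]
    _ ≤ ∫⁻ y, ∏ l, ENNReal.ofReal (Real.exp (φ fun i => y (e (l, i))))
          ∂(ENNReal.ofReal (Real.exp c) • Measure.pi fun _ => ν) := lintegral_mono' hP le_rfl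
    _ = ENNReal.ofReal (Real.exp c) *
          (∫⁻ y, ENNReal.ofReal (Real.exp (φ y)) ∂(Measure.pi fun _ => ν)) ^ M := by
        rw [lintegral_smul_measure, smul_eq_mul,
          lintegral_prod_blocks ν e (F := fun y => ENNReal.ofReal (Real.exp (φ y))) (by fun_prop),
          Fintype.card_fin]
    _ = _ := by
        rw [← ofReal_integral_eq_lintegral_ofReal (integrable_exp_of_abs_le hφ hC)
          (ae_of_all _ fun y => (Real.exp_pos _).le), ← ENNReal.ofReal_pow hI,
          ← ENNReal.ofReal_mul (Real.exp_pos _).le]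

theorem ofReal_mul_sub_le_klDiv [IsProbabilityMeasure P] {m : ProbabilityMeasure (KacSphere N)}
    (hm : IsSymmetric m) (hb : Function.Injective b) (e : Fin M × Fin k ↪ Fin r)
    (hP : P.map (fun v i => v.1.ofLp (b i)) ≤
      ENNReal.ofReal (Real.exp c) • Measure.pi fun _ => ν)
    (hφ : Measurable φ) (hC : ∀ y, |φ y| ≤ C) :
    ENNReal.ofReal (M * (∫ y, φ y ∂(marginal k m : Measure (Fin k → ℝ)) -
      Real.log (∫ y, Real.exp (φ y) ∂(Measure.pi fun _ => ν))) - c) ≤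
      klDiv (m : Measure (KacSphere N)) P := by
  have hΦ : Measurable fun v : KacSphere N => ∑ l, φ (fun i => v.1.ofLp (b (e (l, i)))) := by
    fun_prop
  have hΦC (v : KacSphere N) : |∑ l, φ (fun i => v.1.ofLp (b (e (l, i))))| ≤ M * C :=
    (Finset.abs_sum_le_sum_abs _ _).trans ((Finset.sum_le_sum fun l _ => hC _).trans (by simp))
  refine (ENNReal.ofReal_le_ofReal ?_).trans
    (ofReal_integral_sub_log_integral_exp_le_klDiv (m : Measure (KacSphere N)) P hΦ hΦC)
  have hI := integral_exp_pos (integrable_exp_of_abs_le (μ := Measure.pi fun _ => ν) hφ hC)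
  have hlog := Real.log_le_log (integral_exp_pos (integrable_exp_of_abs_le hΦ hΦC))
    (integral_exp_sum_blocks_le e hP hφ hC)
  rw [Real.log_mul (Real.exp_pos c).ne' (pow_pos hI M).ne', Real.log_exp, Real.log_pow] at hlog
  rw [integral_sum_blocks hm hb e hφ hC]
  linarith

theorem ofReal_div_mul_sub_le_klDiv_div [IsProbabilityMeasure P]
    {m : ProbabilityMeasure (KacSphere N)} (hN : 0 < N) (hm : IsSymmetric m)
    (hb : Function.Injective b) (e : Fin M × Fin k ↪ Fin r)
    (hP : P.map (fun v i => v.1.ofLp (b i)) ≤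
      ENNReal.ofReal (Real.exp (c * N)) • Measure.pi fun _ => ν)
    (hφ : Measurable φ) (hC : ∀ y, |φ y| ≤ C) :
    ENNReal.ofReal ((M : ℝ) / N * (∫ y, φ y ∂(marginal k m : Measure (Fin k → ℝ)) -
      Real.log (∫ y, Real.exp (φ y) ∂(Measure.pi fun _ => ν))) - c) ≤
      klDiv (m : Measure (KacSphere N)) P / N := by
  have hN' : (0 : ℝ) < N := Nat.cast_pos.2 hN
  rw [ENNReal.le_div_iff_mul_le (Or.inl (Nat.cast_ne_zero.2 hN.ne'))
    (Or.inl (ENNReal.natCast_ne_top N)), ← ENNReal.ofReal_natCast, ← ENNReal.ofReal_mul' hN'.le]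
  refine (ENNReal.ofReal_le_ofReal (le_of_eq ?_)).trans
    (ofReal_mul_sub_le_klDiv hm hb e hP hφ hC)
  field_simp

end BlockTest

section EntropyPerParticle

theorem tendsto_natDiv_div_natCast_add {k : ℕ} (hk : 0 < k) (d : ℕ) :
    Tendsto (fun r : ℕ => ((r / k : ℕ) : ℝ) / (r + d : ℕ)) atTop (𝓝 (1 / k)) := by
  have : (0 : ℝ) < k := Nat.cast_pos.2 hk
  have h := ((tendsto_nat_floor_mul_div_atTop (R := ℝ) (a := 1 / k) (by positivity)).comp
    tendsto_natCast_atTop_atTop).mul (tendsto_natCast_div_add_atTop (d : ℝ))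
  rw [mul_one] at h
  refine h.congr' ?_
  filter_upwards [eventually_gt_atTop 0] with r hr
  have : (0 : ℝ) < r := Nat.cast_pos.2 hr
  rw [Function.comp_apply, one_div_mul_eq_div, Nat.floor_div_natCast, Nat.floor_natCast,
    Nat.cast_add]
  field_simp

variable {g : ℝ → ℝ} {m : ∀ N : ℕ, ProbabilityMeasure (KacSphere N)} {k : ℕ}
  {μk : ProbabilityMeasure (Fin k → ℝ)}

theorem eventually_Z_pos_and_lt_top (hg : Measurable g) (hg0 : ∀ x, 0 ≤ g x)
    (h1 : ∫ x, g x = 1) (h2 : ∫ x, g x * x ^ 2 = 1) {p : ℝ≥0∞} (hp : 1 < p) (hgp : MemLp g p) :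
    ∀ᶠ N : ℕ in atTop, 0 < Z g N ∧ Z g N < ∞ := by
  have := isProbabilityMeasure_densityMeasure hg0 h1
  obtain ⟨d, K, hK, hle⟩ :=
    exists_lconvPow_sqDensity_le hg hg0 (integrable_of_integral_eq_one h1) hp hgp
  refine (eventually_Z_pos hg hg0 h2).and ?_
  rw [← map_add_atTop_eq_nat (d + 1), eventually_map]
  exact Eventually.of_forall (Z_lt_top hg hK hle)

theorem ofReal_div_sub_le_liminf_klDiv_div (hg : Measurable g) (hg0 : ∀ x, 0 ≤ g x)
    (h1 : ∫ x, g x = 1) (h2 : ∫ x, g x * x ^ 2 = 1) {p : ℝ≥0∞} (hp : 1 < p) (hgp : MemLp g p)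
    (hm : ∀ N, 0 < N → IsSymmetric (m N)) (hk : 0 < k)
    (hlim : Tendsto (fun N => marginal k (m N)) atTop (𝓝 μk))
    (φ : BoundedContinuousFunction (Fin k → ℝ) ℝ) {ε : ℝ} (hε : 0 < ε) :
    ENNReal.ofReal ((∫ y, φ y ∂(μk : Measure (Fin k → ℝ)) -
      Real.log (∫ y, Real.exp (φ y) ∂(Measure.pi fun _ => densityMeasure g))) / k - ε) ≤
      liminf (fun N : ℕ => klDiv (m N : Measure (KacSphere N)) (condTensor g N) / N) atTop := by
  have := isProbabilityMeasure_densityMeasure hg0 h1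
  obtain ⟨d, K, hK, hle⟩ :=
    exists_lconvPow_sqDensity_le hg hg0 (integrable_of_integral_eq_one h1) hp hgp
  set Λ := Real.log (∫ y, Real.exp (φ y) ∂(Measure.pi fun _ => densityMeasure g))
  have hbound : Tendsto (fun r : ℕ => ENNReal.ofReal (((r / k : ℕ) : ℝ) / (r + (d + 1) : ℕ) *
      (∫ y, φ y ∂(marginal k (m (r + (d + 1))) : Measure (Fin k → ℝ)) - Λ) - ε)) atTop
      (𝓝 (ENNReal.ofReal ((∫ y, φ y ∂(μk : Measure (Fin k → ℝ)) - Λ) / k - ε))) := by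
    have hφlim := (ProbabilityMeasure.tendsto_iff_forall_integral_tendsto.1 hlim φ).comp
      (tendsto_add_atTop_nat (d + 1))
    rw [← one_div_mul_eq_div]
    exact (ENNReal.continuous_ofReal.tendsto _).comp
      (((tendsto_natDiv_div_natCast_add hk (d + 1)).mul (hφlim.sub_const Λ)).sub_const ε)
  rw [← liminf_nat_add _ (d + 1), ← hbound.liminf_eq]
  refine liminf_le_liminf ?_
  filter_upwards [eventually_map_condTensor_le hg hg0 h2 hK hle hε,
    (tendsto_add_atTop_nat (d + 1)).eventually (eventually_Z_pos hg hg0 h2)] with r hP hZ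
  have := isProbabilityMeasure_condTensor hZ.ne' (Z_lt_top hg hK hle r).ne
  have hr : 0 < r + (d + 1) := Nat.succ_pos _
  exact ofReal_div_mul_sub_le_klDiv_div hr (hm _ hr) (Fin.addNatEmb (d + 1)).injective
    (finProdFinEquiv.toEmbedding.trans (Fin.castLEEmb (Nat.div_mul_le_self r k))) hP
    φ.continuous.measurable φ.norm_coe_le_norm

theorem ofReal_div_le_liminf_klDiv_div (hg : Measurable g) (hg0 : ∀ x, 0 ≤ g x)
    (h1 : ∫ x, g x = 1) (h2 : ∫ x, g x * x ^ 2 = 1) {p : ℝ≥0∞} (hp : 1 < p) (hgp : MemLp g p)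
    (hm : ∀ N, 0 < N → IsSymmetric (m N)) (hk : 0 < k)
    (hlim : Tendsto (fun N => marginal k (m N)) atTop (𝓝 μk))
    (φ : BoundedContinuousFunction (Fin k → ℝ) ℝ) :
    ENNReal.ofReal ((∫ y, φ y ∂(μk : Measure (Fin k → ℝ)) -
      Real.log (∫ y, Real.exp (φ y) ∂(Measure.pi fun _ => densityMeasure g))) / k) ≤
      liminf (fun N : ℕ => klDiv (m N : Measure (KacSphere N)) (condTensor g N) / N) atTop := by
  refine ENNReal.le_of_forall_pos_le_add fun ε hε _ => ?_
  refine le_trans ?_ (add_le_add_left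
    (ofReal_div_sub_le_liminf_klDiv_div hg hg0 h1 h2 hp hgp hm hk hlim φ hε) _)
  rw [← ENNReal.ofReal_coe_nnreal]
  exact (ENNReal.ofReal_le_ofReal (sub_add_cancel _ _).ge).trans ENNReal.ofReal_add_le

theorem klDiv_div_le_liminf (hg : Measurable g) (hg0 : ∀ x, 0 ≤ g x)
    (h1 : ∫ x, g x = 1) (h2 : ∫ x, g x * x ^ 2 = 1) {p : ℝ≥0∞} (hp : 1 < p) (hgp : MemLp g p)
    (hm : ∀ N, 0 < N → IsSymmetric (m N)) (hk : 0 < k)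
    (hlim : Tendsto (fun N => marginal k (m N)) atTop (𝓝 μk)) :
    klDiv (μk : Measure (Fin k → ℝ)) (Measure.pi fun _ => densityMeasure g) / k ≤
      liminf (fun N : ℕ => klDiv (m N : Measure (KacSphere N)) (condTensor g N) / N) atTop := by
  have := isProbabilityMeasure_densityMeasure hg0 h1
  have htest := ofReal_div_le_liminf_klDiv_div hg hg0 h1 h2 hp hgp hm hk hlim
  set L := liminf (fun N : ℕ => klDiv (m N : Measure (KacSphere N)) (condTensor g N) / N) atTop
  obtain hL | hL := eq_or_ne L ∞
  · exact hL ▸ le_top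
  have hkl := klDiv_le_of_forall_boundedContinuous (μk : Measure (Fin k → ℝ))
    (Measure.pi fun _ => densityMeasure g) (L := L.toReal * k) fun φ => by
      rw [← div_le_iff₀ (Nat.cast_pos.2 hk)]
      exact (ENNReal.ofReal_le_iff_le_toReal hL).1 (htest φ)
  refine ENNReal.div_le_of_le_mul (hkl.trans_eq ?_)
  rw [ENNReal.ofReal_mul ENNReal.toReal_nonneg, ENNReal.ofReal_toReal hL, ENNReal.ofReal_natCast]

theorem map_const_marginalOne {N : ℕ} (m : ProbabilityMeasure (KacSphere N)) :
    (marginalOne m).map (f := fun t (_ : Fin 1) => t) (by fun_prop) = marginal 1 m := by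
  refine Subtype.ext ?_
  rw [marginalOne, ProbabilityMeasure.val_eq_to_measure, ProbabilityMeasure.val_eq_to_measure,
    ProbabilityMeasure.toMeasure_map, ProbabilityMeasure.toMeasure_map,
    Measure.map_map (by fun_prop) (by fun_prop)]
  convert Measure.map_id
  ext y i
  simp [Subsingleton.elim i 0]

theorem klDiv_le_klDiv_map_const (μ ν : Measure ℝ) [IsProbabilityMeasure μ]
    [IsProbabilityMeasure ν] :
    klDiv μ ν ≤ klDiv (μ.map fun t (_ : Fin 1) => t) (Measure.pi fun _ => ν) := by
  have h := klDiv_map_le (μ := μ.map fun t (_ : Fin 1) => t) (ν := Measure.pi fun _ => ν)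
    (measurable_pi_apply (0 : Fin 1))
  rw [(measurePreserving_eval (fun _ : Fin 1 => ν) 0).map_eq,
    Measure.map_map (by fun_prop) (by fun_prop)] at h
  simpa [Function.comp_def] using h

theorem klDiv_le_liminf (hg : Measurable g) (hg0 : ∀ x, 0 ≤ g x)
    (h1 : ∫ x, g x = 1) (h2 : ∫ x, g x * x ^ 2 = 1) {p : ℝ≥0∞} (hp : 1 < p) (hgp : MemLp g p)
    (hm : ∀ N, 0 < N → IsSymmetric (m N))
    {μ : ProbabilityMeasure ℝ} (hlim : Tendsto (fun N => marginalOne (m N)) atTop (𝓝 μ)) :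
    klDiv (μ : Measure ℝ) (densityMeasure g) ≤
      liminf (fun N : ℕ => klDiv (m N : Measure (KacSphere N)) (condTensor g N) / N) atTop := by
  have := isProbabilityMeasure_densityMeasure hg0 h1
  have hmap := ProbabilityMeasure.tendsto_map_of_tendsto_of_continuous _ _ hlim
    (f := fun t (_ : Fin 1) => t) (by fun_prop)
  simp only [map_const_marginalOne] at hmap
  have hle := klDiv_div_le_liminf hg hg0 h1 h2 hp hgp hm one_pos hmap
  rw [Nat.cast_one, div_one] at hle
  exact (klDiv_le_klDiv_map_const _ _).trans hle

end EntropyPerParticle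

section Gaussian

theorem densityMeasure_gaussianPDFReal :
    densityMeasure (gaussianPDFReal 0 1) = gaussianReal 0 1 := by
  rw [gaussianReal_of_var_ne_zero 0 one_ne_zero]
  rfl

theorem integral_gaussianPDFReal_mul_sq : ∫ x, gaussianPDFReal 0 1 x * x ^ 2 = 1 := by
  rw [← integral_densityMeasure (measurable_gaussianPDFReal 0 1) (gaussianPDFReal_nonneg 0 1)
    (fun x => x ^ 2), densityMeasure_gaussianPDFReal]
  have h := variance_fun_id_gaussianReal (μ := 0) (v := 1)
  rw [variance_eq_integral (by fun_prop), integral_id_gaussianReal] at h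
  simpa using h

theorem memLp_top_gaussianPDFReal : MemLp (gaussianPDFReal 0 1) ∞ := by
  refine memLp_top_of_bound (measurable_gaussianPDFReal 0 1).aestronglyMeasurable
    ((√(2 * Real.pi * 1))⁻¹) (ae_of_all _ fun x => ?_)
  rw [Real.norm_of_nonneg (gaussianPDFReal_nonneg 0 1 x), gaussianPDFReal_def]
  refine mul_le_of_le_one_right (by positivity) (Real.exp_le_one_iff.2 ?_)
  rw [neg_div]
  exact neg_nonpos.2 (by positivity)

theorem sum_sq_kacSphere {N : ℕ} (v : KacSphere N) : ∑ j, v.1.ofLp j ^ 2 = N := by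
  have h := sqSum_ofLp v.1
  rwa [norm_eq_of_mem_sphere, Real.sq_sqrt (Nat.cast_nonneg N)] at h

theorem tensorDensity_gaussianPDFReal (N : ℕ) (v : KacSphere N) :
    tensorDensity (gaussianPDFReal 0 1) N v =
      ENNReal.ofReal ((√(2 * Real.pi * 1))⁻¹ ^ N * Real.exp (-N / 2)) := by
  rw [tensorDensity, ← ENNReal.ofReal_prod_of_nonneg fun _ _ => gaussianPDFReal_nonneg 0 1 _]
  simp only [gaussianPDFReal_def, sub_zero, NNReal.coe_one, mul_one, Finset.prod_mul_distrib,
    Finset.prod_const, Finset.card_univ, Fintype.card_fin, ← Real.exp_sum, ← Finset.sum_div,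
    Finset.sum_neg_distrib, sum_sq_kacSphere v]

theorem condTensor_gaussianPDFReal (n : ℕ) :
    condTensor (gaussianPDFReal 0 1) (n + 1) = unif (n + 1) := by
  have hconst := funext (tensorDensity_gaussianPDFReal (n + 1))
  rw [condTensor, Z, hconst, lintegral_const, measure_univ, mul_one, withDensity_const, smul_smul,
    ENNReal.inv_mul_cancel (ENNReal.ofReal_pos.2 (by positivity)).ne' ENNReal.ofReal_ne_top,
    one_smul]

theorem klDiv_gaussianReal_le_liminf {m : ∀ N : ℕ, ProbabilityMeasure (KacSphere N)}
    (hm : ∀ N, 0 < N → IsSymmetric (m N)) {μ : ProbabilityMeasure ℝ}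
    (hlim : Tendsto (fun N => marginalOne (m N)) atTop (𝓝 μ)) :
    klDiv (μ : Measure ℝ) (gaussianReal 0 1) ≤
      liminf (fun N : ℕ => klDiv (m N : Measure (KacSphere N)) (unif N) / N) atTop := by
  have h := klDiv_le_liminf (measurable_gaussianPDFReal 0 1) (gaussianPDFReal_nonneg 0 1)
    (integral_gaussianPDFReal_eq_one 0 one_ne_zero) integral_gaussianPDFReal_mul_sq
    ENNReal.one_lt_top memLp_top_gaussianPDFReal hm hlim
  rw [densityMeasure_gaussianPDFReal] at h
  refine h.trans_eq (liminf_congr ?_)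
  filter_upwards [eventually_gt_atTop 0] with N hN
  obtain ⟨n, rfl⟩ := Nat.exists_eq_add_of_lt hN
  rw [zero_add, condTensor_gaussianPDFReal]

end Gaussian

theorem tendsto_marginalOne_of_isChaotic {μ : ProbabilityMeasure ℝ}
    {m : ∀ N : ℕ, ProbabilityMeasure (KacSphere N)} (h : IsChaotic μ m) :
    Tendsto (fun N => marginalOne (m N)) atTop (𝓝 μ) := by
  have hlim := ProbabilityMeasure.tendsto_map_of_tendsto_of_continuous _ _ (h.2 1 one_pos)
    (continuous_apply (0 : Fin 1))
  have hμ : (tensorPower μ 1).map (measurable_pi_apply (0 : Fin 1)).aemeasurable = μ :=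
    Subtype.ext (measurePreserving_eval (fun _ : Fin 1 => (μ : Measure ℝ)) 0).map_eq
  rwa [hμ] at hlim

end KacChaos

theorem mainTheorem5_general :
    (∀ g : ℝ → ℝ, Measurable g → (∀ x, 0 ≤ g x) → ∫ x, g x = 1 →
      ∫ x, g x * x ^ 2 = 1 → (∃ p : ℝ≥0∞, 1 < p ∧ MemLp g p) →
      (∀ᶠ N : ℕ in atTop, 0 < KacChaos.Z g N ∧ KacChaos.Z g N < ∞) ∧
      ∀ m : ∀ N : ℕ, ProbabilityMeasure (KacChaos.KacSphere N),
        (∀ N, 0 < N → KacChaos.IsSymmetric (m N)) →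
        (∀ μ : ProbabilityMeasure ℝ,
          Tendsto (fun N => KacChaos.marginalOne (m N)) atTop (𝓝 μ) →
          klDiv (μ : Measure ℝ) (KacChaos.densityMeasure g) ≤
            liminf (fun N : ℕ =>
              klDiv (m N : Measure (KacChaos.KacSphere N)) (KacChaos.condTensor g N) / N)
              atTop) ∧
        (∀ k : ℕ, 0 < k → ∀ μk : ProbabilityMeasure (Fin k → ℝ),
          Tendsto (fun N => KacChaos.marginal k (m N)) atTop (𝓝 μk) →
          klDiv (μk : Measure (Fin k → ℝ))
              (Measure.pi fun _ : Fin k => KacChaos.densityMeasure g) / k ≤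
            liminf (fun N : ℕ =>
              klDiv (m N : Measure (KacChaos.KacSphere N)) (KacChaos.condTensor g N) / N)
              atTop)) ∧
    (∀ (μ : ProbabilityMeasure ℝ) (m : ∀ N : ℕ, ProbabilityMeasure (KacChaos.KacSphere N)),
      (∀ N, 0 < N → KacChaos.IsSymmetric (m N)) →
      Tendsto (fun N => KacChaos.marginalOne (m N)) atTop (𝓝 μ) →
      klDiv (μ : Measure ℝ) (gaussianReal 0 1) ≤
        liminf (fun N : ℕ =>
          klDiv (m N : Measure (KacChaos.KacSphere N)) (KacChaos.unif N) / N) atTop) := by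
  refine ⟨fun g hg hg0 h1 h2 ⟨p, hp, hgp⟩ => ?_,
    fun μ m hm hμ => KacChaos.klDiv_gaussianReal_le_liminf hm hμ⟩
  exact ⟨KacChaos.eventually_Z_pos_and_lt_top hg hg0 h1 h2 hp hgp, fun m hm =>
    ⟨fun μ hμ => KacChaos.klDiv_le_liminf hg hg0 h1 h2 hp hgp hm hμ,
      fun k hk μk hμk => KacChaos.klDiv_div_le_liminf hg hg0 h1 h2 hp hgp hm hk hμk⟩⟩

theorem mainTheorem5 :
    (∀ g : ℝ → ℝ, Measurable g → (∀ x, 0 ≤ g x) → ∫ x, g x = 1 →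
      ∫ x, g x * x ^ 2 = 1 → Integrable (fun x => g x * x ^ 4) →
      (∃ p : ℝ≥0∞, 1 < p ∧ MemLp g p) →
      (∀ᶠ N : ℕ in atTop, 0 < KacChaos.Z g N ∧ KacChaos.Z g N < ∞) ∧
      ∀ m : ∀ N : ℕ, ProbabilityMeasure (KacChaos.KacSphere N),
        (∀ N, 0 < N → KacChaos.IsSymmetric (m N)) →
        (∀ μ : ProbabilityMeasure ℝ,
          Tendsto (fun N => KacChaos.marginalOne (m N)) atTop (𝓝 μ) →
          klDiv (μ : Measure ℝ) (KacChaos.densityMeasure g) ≤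
            liminf (fun N : ℕ =>
              klDiv (m N : Measure (KacChaos.KacSphere N)) (KacChaos.condTensor g N) / N)
              atTop) ∧
        (∀ k : ℕ, 0 < k → ∀ μk : ProbabilityMeasure (Fin k → ℝ),
          Tendsto (fun N => KacChaos.marginal k (m N)) atTop (𝓝 μk) →
          klDiv (μk : Measure (Fin k → ℝ))
              (Measure.pi fun _ : Fin k => KacChaos.densityMeasure g) / k ≤
            liminf (fun N : ℕ =>
              klDiv (m N : Measure (KacChaos.KacSphere N)) (KacChaos.condTensor g N) / N)
              atTop)) ∧
    (∀ (μ : ProbabilityMeasure ℝ) (m : ∀ N : ℕ, ProbabilityMeasure (KacChaos.KacSphere N)),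
      KacChaos.IsChaotic μ m →
      klDiv (μ : Measure ℝ) (gaussianReal 0 1) ≤
        liminf (fun N : ℕ =>
          klDiv (m N : Measure (KacChaos.KacSphere N)) (KacChaos.unif N) / N) atTop) :=
  ⟨fun g hg hg0 h1 h2 _ hp => mainTheorem5_general.1 g hg hg0 h1 h2 hp, fun μ m hm =>
    mainTheorem5_general.2 μ m hm.1 (KacChaos.tendsto_marginalOne_of_isChaotic hm)⟩
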